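/- Let $K\ge 2$ and $N\ge 1$ be integers and $r,\sigma>0$. For $\theta=(\theta_{k,1},\theta_{k,2})_{k=1}^K\in\mathbb R^{2K}$ put $r_k(\theta)=(\theta_{k,1}^2+\theta_{k,2}^2)^{1/2}$, and for $\alpha\in\mathbb R$ let $g(\alpha)\cdot\theta$ be the vector obtained from $\theta$ by applying, for each $k=1,\dots,K$, the matrix $\begin{pmatrix}\cos k\alpha&-\sin k\alpha\\ \sin k\alpha&\cos k\alpha\end{pmatrix}$ to $(\theta_{k,1},\theta_{k,2})$. Define the loss \[L(\theta,\theta')=\min_{\alpha\in[-\pi,\pi)}\|\theta-g(\alpha)\cdot\theta'\|^2\] and the parameter space \[\mathcal P(r)=\{\theta\in\mathbb R^{2K}: r_k(\theta)=r\text{ for all }k=1,\dots,K\}.\] For $\theta^*\in\mathbb R^{2K}$ let $\mathbb E_{\theta^*}$ denote the expectation over $N$ i.i.d. samples \[y^{(m)}=g(\alpha^{(m)})\cdot\theta^*+\sigma\varepsilon^{(m)},\qquad m=1,\dots,N,\] where $\alpha^{(m)}\sim\mathrm{Unif}([-\pi,\pi))$ and $\varepsilon^{(m)}\sim\mathcal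 N(0,I_{2K})$ are all independent. Then there is a universal constant $c>0$, not depending on $K,N,r,\sigma$, such that for all such $K,N,r,\sigma$ \[\inf_{\hat\theta}\ \sup_{\theta^*\in\mathcal P(r)}\mathbb E_{\theta^*}\big[L(\theta^*,\hat\theta)\big]\ \ge\ c\cdot\min\left(\max\left(\frac{K\sigma^2}{N},\ \frac{\sigma^6}{N r^4 e^{3Kr^2/(2\sigma^2)}}\right),\ Kr^2\right),\] where the infimum is over all (measurable) estimators $\hat\theta=\hat\theta(y^{(1)},\dots,y^{(N)})\in\mathbb R^{2K}$. -/

import Mathlib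

open MeasureTheory ProbabilityTheory

noncomputable section

namespace OrbitEstimation

/-- The space `ℝ^{2K}` of Fourier coefficient vectors with its Euclidean norm. The entry at
`(k, 0)` is the cosine coefficient and the entry at `(k, 1)` the sine coefficient of the
frequency `k + 1`, where `k : Fin K` runs through `0, …, K - 1`. -/
abbrev Coeff (K : ℕ) : Type := EuclideanSpace ℝ (Fin K × Fin 2)

/-- The action `θ ↦ g(α) · θ` of the rotation by the angle `α`: the coefficient pair of the
frequency `k + 1` is rotated by the angle `(k + 1) α`. -/
def rotate {K : ℕ} (α : ℝ) (θ : Coeff K) : Coeff K :=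
  WithLp.toLp 2 fun p : Fin K × Fin 2 =>
    (Matrix.mulVec
      !![Real.cos (((p.1 : ℕ) + 1 : ℝ) * α), -Real.sin (((p.1 : ℕ) + 1 : ℝ) * α);
         Real.sin (((p.1 : ℕ) + 1 : ℝ) * α), Real.cos (((p.1 : ℕ) + 1 : ℝ) * α)]
      ![θ (p.1, 0), θ (p.1, 1)]) p.2

/-- The magnitude `r_k(θ)` of the Fourier coefficient pair with index `k`. -/
def magnitude {K : ℕ} (θ : Coeff K) (k : Fin K) : ℝ :=
  Real.sqrt (θ (k, 0) ^ 2 + θ (k, 1) ^ 2)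

/-- The parameter space `𝒫(r)`: all Fourier magnitudes are equal to `r`. -/
def paramSpace (K : ℕ) (r : ℝ) : Set (Coeff K) :=
  {θ | ∀ k : Fin K, magnitude θ k = r}

/-- The rotation-invariant loss `L(θ, θ') = min_{α ∈ [-π, π)} ‖θ - g(α) · θ'‖²`. -/
def loss {K : ℕ} (θ θ' : Coeff K) : ℝ :=
  ⨅ α : Set.Ico (-Real.pi) Real.pi, ‖θ - rotate (α : ℝ) θ'‖ ^ 2

/-- The uniform distribution on `[-π, π)`. -/
def unifAngle : Measure ℝ := cond volume (Set.Ico (-Real.pi) Real.pi)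

/-- The law of one observation `y = g(α) · θ + σ ε`, where `α` is uniform on `[-π, π)` and
`ε` is an independent standard Gaussian vector in `ℝ^{2K}`. -/
def sampleLaw {K : ℕ} (σ : ℝ) (θ : Coeff K) : Measure (Coeff K) :=
  (unifAngle.prod (stdGaussian (Coeff K))).map
    fun p : ℝ × Coeff K => rotate p.1 θ + σ • p.2

lemma measurable_sample {K : ℕ} (σ : ℝ) (θ : Coeff K) :
    Measurable fun p : ℝ × Coeff K => rotate p.1 θ + σ • p.2 := by
  have h : Continuous fun α : ℝ => rotate α θ := by
    unfold rotate
    refine (PiLp.continuous_toLp 2 _).comp (continuous_pi ?_)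
    rintro ⟨k, j⟩
    fin_cases j <;> simp [Matrix.mulVec, dotProduct] <;> fun_prop
  exact ((h.comp continuous_fst).add (continuous_snd.const_smul σ)).measurable

instance : IsProbabilityMeasure unifAngle := by
  unfold unifAngle
  refine cond_isProbabilityMeasure_of_finite ?_ ?_ <;> simp [Real.volume_Ico, Real.pi_pos]

instance {K : ℕ} (σ : ℝ) (θ : Coeff K) : IsProbabilityMeasure (sampleLaw σ θ) :=
  Measure.isProbabilityMeasure_map (measurable_sample σ θ).aemeasurable

/-- The joint law of `N` independent observations `y⁽¹⁾, …, y⁽ᴺ⁾`. -/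
def dataLaw {K : ℕ} (N : ℕ) (σ : ℝ) (θ : Coeff K) : Measure (Fin N → Coeff K) :=
  Measure.pi fun _ => sampleLaw σ θ

/-- The risk `𝔼_θ[L(θ, θ̂)] ∈ [0, ∞]` of an estimator `θ̂`, a function of the `N` samples. -/
def risk {K : ℕ} (N : ℕ) (σ : ℝ) (est : (Fin N → Coeff K) → Coeff K) (θ : Coeff K) : ENNReal :=
  ∫⁻ y, ENNReal.ofReal (loss θ (est y)) ∂(dataLaw N σ θ)

/-- The minimax risk `inf_{θ̂} sup_{θ ∈ 𝒫(r)} 𝔼_θ[L(θ, θ̂)] ∈ [0, ∞]`, the infimum being over all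
measurable functions `θ̂` of the `N` samples. -/
def minimaxRisk (K N : ℕ) (σ r : ℝ) : ENNReal :=
  ⨅ est : {f : (Fin N → Coeff K) → Coeff K // Measurable f},
    ⨆ θ : paramSpace K r, risk N σ est.1 θ.1

end OrbitEstimation

end

/-!
Assouad's lemma is applied to signals whose phases at the upper half of the frequencies are `0` or
`η`, while the phases at the lower half are `0`. A rotation by `α` that compensates a phase
difference at a high frequency must pay for it at the low ones, because the squared chords of the
angles `(k + 1) α` satisfy a quasi-triangle inequality in `k`. Hence the loss separates the cube
like the Hamming distance, and it remains to bound the `χ²`-divergence of two orbit mixtures that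
differ in a single phase.

Convexity always bounds it by `exp (η² r² / σ²) - 1`, which gives the rate `K σ² / N`. When `r / σ`
is small, the `L²`-distance of the two mixture densities is the average over `α` of
`exp (t D(α))` times a second difference of `exp (t cos x)`, where `t = r² / σ²` and `D` is the sum
of the cosines `cos ((k + 1) α)` of the unchanged frequencies. By orthogonality of the cosines the
terms of order `t` and `t²` average to zero, which leaves a divergence of order
`t³ K η² exp (3 K t / 2)` and the second rate.
-/

noncomputable section

namespace OrbitEstimation

section Product

variable {ι : Type*} [Fintype ι] {X : ι → Type*} [∀ i, MeasurableSpace (X i)]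
  (μ : ∀ i, Measure (X i)) [∀ i, IsProbabilityMeasure (μ i)] {f : ∀ i, X i → ENNReal}

lemma lintegral_pi_prod (hf : ∀ i, Measurable (f i)) :
    ∫⁻ x, ∏ i, f i (x i) ∂(Measure.pi μ) = ∏ i, ∫⁻ x, f i x ∂(μ i) := by
  refine (lintegral_prod_eq_prod_lintegral_of_indepFun Finset.univ
    (fun i (x : ∀ i, X i) => f i (x i)) (iIndepFun_pi fun i => (hf i).aemeasurable)
    fun i => (hf i).comp (measurable_pi_apply i)).trans ?_
  refine Finset.prod_congr rfl fun i _ => ?_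
  rw [← (measurePreserving_eval μ i).map_eq, lintegral_map (hf i) (measurable_pi_apply i)]

lemma pi_withDensity (hf : ∀ i, Measurable (f i)) [∀ i, SigmaFinite ((μ i).withDensity (f i))] :
    Measure.pi (fun i => (μ i).withDensity (f i)) =
      (Measure.pi μ).withDensity fun x => ∏ i, f i (x i) := by
  refine Measure.pi_eq fun s hs => ?_
  have indicator_prod (x : ∀ i, X i) : (Set.univ.pi s).indicator (fun x => ∏ i, f i (x i)) x =
      ∏ i, (s i).indicator (f i) (x i) := by
    by_cases hx : x ∈ Set.univ.pi s
    · rw [Set.indicator_of_mem hx]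
      exact Finset.prod_congr rfl fun i _ => (Set.indicator_of_mem (hx i trivial) _).symm
    · rw [Set.indicator_of_notMem hx]
      obtain ⟨i, hi⟩ : ∃ i, x i ∉ s i := by simpa using hx
      exact (Finset.prod_eq_zero (Finset.mem_univ i) (Set.indicator_of_notMem hi _)).symm
  rw [withDensity_apply _ (MeasurableSet.univ_pi hs),
    ← lintegral_indicator (MeasurableSet.univ_pi hs)]
  simp_rw [indicator_prod]
  rw [lintegral_pi_prod μ fun i => (hf i).indicator (hs i)]
  refine Finset.prod_congr rfl fun i _ => ?_
  rw [lintegral_indicator (hs i), withDensity_apply _ (hs i)]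

end Product

section ChiSquare

variable {Ω : Type*} [MeasurableSpace Ω]

/-- The second moment `∫ (dP/dQ)² dQ = 1 + χ²(P, Q)` of the likelihood ratio of two laws `P` and
`Q` with densities `p` and `q` with respect to `μ`. Unlike `χ²` itself it is multiplicative over
independent samples. -/
def chiSqMoment (μ : Measure Ω) (p q : Ω → ℝ) : ENNReal :=
  ∫⁻ x, ENNReal.ofReal (p x ^ 2 / q x) ∂μ

variable {μ : Measure Ω} {p q : Ω → ℝ}

lemma chiSqMoment_pi [IsProbabilityMeasure μ] (hp : Measurable p) (hq : Measurable q)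
    (hq0 : ∀ x, 0 ≤ q x) (ι : Type*) [Fintype ι] :
    chiSqMoment (Measure.pi fun _ : ι => μ) (fun x => ∏ i, p (x i)) (fun x => ∏ i, q (x i)) =
      chiSqMoment μ p q ^ Fintype.card ι := by
  have ofReal_ratio (x : ι → Ω) : ENNReal.ofReal ((∏ i, p (x i)) ^ 2 / ∏ i, q (x i)) =
      ∏ i, ENNReal.ofReal (p (x i) ^ 2 / q (x i)) := by
    rw [← Finset.prod_pow, ← Finset.prod_div_distrib,
      ENNReal.ofReal_prod_of_nonneg fun i _ => div_nonneg (sq_nonneg _) (hq0 _)]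
  simp_rw [chiSqMoment, ofReal_ratio]
  rw [lintegral_pi_prod (fun _ : ι => μ) (f := fun _ x => ENNReal.ofReal (p x ^ 2 / q x))
    fun _ => by fun_prop, Finset.prod_const, Finset.card_univ]

lemma withDensity_apply_le_chiSqMoment_add (hp : Measurable p) (hq : Measurable q)
    (hq0 : ∀ x, 0 < q x) {A : Set Ω} (hA : MeasurableSet A) :
    μ.withDensity (fun x => ENNReal.ofReal (p x)) A ≤
      ENNReal.ofReal (1 / 4) * chiSqMoment μ p q +
        μ.withDensity (fun x => ENNReal.ofReal (q x)) A := by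
  have le_ratio (x : Ω) : p x ≤ 1 / 4 * (p x ^ 2 / q x) + q x := by
    have hdiff : 1 / 4 * (p x ^ 2 / q x) + q x - p x = (p x / 2 - q x) ^ 2 / q x := by
      have := (hq0 x).ne'
      field_simp
      ring
    have : 0 ≤ (p x / 2 - q x) ^ 2 / q x := div_nonneg (sq_nonneg _) (hq0 x).le
    linarith
  rw [withDensity_apply _ hA, withDensity_apply _ hA]
  calc ∫⁻ x in A, ENNReal.ofReal (p x) ∂μ
      ≤ ∫⁻ x in A, (ENNReal.ofReal (1 / 4) * ENNReal.ofReal (p x ^ 2 / q x) +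
          ENNReal.ofReal (q x)) ∂μ := by
        refine lintegral_mono fun x => ?_
        rw [← ENNReal.ofReal_mul (by norm_num), ← ENNReal.ofReal_add
          (mul_nonneg (by norm_num) (div_nonneg (sq_nonneg _) (hq0 x).le)) (hq0 x).le]
        exact ENNReal.ofReal_le_ofReal (le_ratio x)
    _ = ENNReal.ofReal (1 / 4) * ∫⁻ x in A, ENNReal.ofReal (p x ^ 2 / q x) ∂μ +
          ∫⁻ x in A, ENNReal.ofReal (q x) ∂μ := by
        rw [lintegral_add_right _ (by fun_prop), lintegral_const_mul _ (by fun_prop)]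
    _ ≤ _ := by
        gcongr
        exact setLIntegral_le_lintegral _ _

lemma half_le_withDensity_add_compl (hp : Measurable p) (hq : Measurable q) (hq0 : ∀ x, 0 < q x)
    [IsProbabilityMeasure (μ.withDensity fun x => ENNReal.ofReal (p x))]
    (hpq : chiSqMoment μ p q ≤ 2) {A : Set Ω} (hA : MeasurableSet A) :
    1 / 2 ≤ μ.withDensity (fun x => ENNReal.ofReal (q x)) A +
      μ.withDensity (fun x => ENNReal.ofReal (p x)) Aᶜ := by
  set P := μ.withDensity fun x => ENNReal.ofReal (p x)
  set Q := μ.withDensity fun x => ENNReal.ofReal (q x)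
  have hPA : P A ≤ 1 / 2 + Q A := by
    refine (withDensity_apply_le_chiSqMoment_add hp hq hq0 hA).trans (add_le_add_left ?_ _)
    calc ENNReal.ofReal (1 / 4) * chiSqMoment μ p q
        ≤ ENNReal.ofReal (1 / 4) * ENNReal.ofReal 2 := by
          gcongr
          simpa using hpq
      _ = 1 / 2 := by
          rw [← ENNReal.ofReal_mul (by norm_num), one_div (2 : ENNReal), ← ENNReal.ofReal_ofNat 2,
            ← ENNReal.ofReal_inv_of_pos (by norm_num)]
          norm_num
  have htotal : 1 / 2 + 1 / 2 ≤ 1 / 2 + (Q A + P Aᶜ) := by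
    calc 1 / 2 + 1 / 2 = P A + P Aᶜ := by
          rw [ENNReal.add_halves, prob_add_prob_compl hA]
      _ ≤ 1 / 2 + Q A + P Aᶜ := by gcongr
      _ = 1 / 2 + (Q A + P Aᶜ) := add_assoc _ _ _
  exact ENNReal.le_of_add_le_add_left (by simp) htotal

lemma exp_half_le_two : Real.exp (1 / 2) ≤ 2 :=
  (Real.exp_bound_div_one_sub_of_interval (by norm_num) (by norm_num)).trans (by norm_num)

lemma half_le_pi_withDensity_add_compl [IsProbabilityMeasure μ]
    (hp : Measurable p) (hp0 : ∀ x, 0 ≤ p x) (hq : Measurable q) (hq0 : ∀ x, 0 < q x)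
    [IsProbabilityMeasure (μ.withDensity fun x => ENNReal.ofReal (p x))]
    [IsProbabilityMeasure (μ.withDensity fun x => ENNReal.ofReal (q x))] {n : ℕ} {x : ℝ}
    (hx : n * x ≤ 1 / 2) (hpq : chiSqMoment μ p q ≤ ENNReal.ofReal (Real.exp x))
    {A : Set (Fin n → Ω)} (hA : MeasurableSet A) :
    1 / 2 ≤ (Measure.pi fun _ : Fin n => μ.withDensity fun x => ENNReal.ofReal (q x)) A +
      (Measure.pi fun _ : Fin n => μ.withDensity fun x => ENNReal.ofReal (p x)) Aᶜ := by
  have pi_density {f : Ω → ℝ} (hf : Measurable f) (hf0 : ∀ x, 0 ≤ f x)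
      [IsProbabilityMeasure (μ.withDensity fun x => ENNReal.ofReal (f x))] :
      (Measure.pi fun _ : Fin n => μ.withDensity fun x => ENNReal.ofReal (f x)) =
        (Measure.pi fun _ => μ).withDensity fun x => ENNReal.ofReal (∏ i, f (x i)) := by
    rw [pi_withDensity (fun _ : Fin n => μ) fun _ => by fun_prop]
    simp_rw [ENNReal.ofReal_prod_of_nonneg fun _ _ => hf0 _]
  have hchi : chiSqMoment (Measure.pi fun _ : Fin n => μ) (fun x => ∏ i, p (x i))
      (fun x => ∏ i, q (x i)) ≤ 2 := by
    rw [chiSqMoment_pi hp hq (fun x => (hq0 x).le), Fintype.card_fin]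
    calc chiSqMoment μ p q ^ n ≤ ENNReal.ofReal (Real.exp x) ^ n := by gcongr
      _ = ENNReal.ofReal (Real.exp (n * x)) := by
          rw [← ENNReal.ofReal_pow (Real.exp_nonneg x), ← Real.exp_nat_mul]
      _ ≤ ENNReal.ofReal 2 :=
          ENNReal.ofReal_le_ofReal ((Real.exp_le_exp.2 hx).trans exp_half_le_two)
      _ = 2 := ENNReal.ofReal_ofNat 2
  have : IsProbabilityMeasure ((Measure.pi fun _ : Fin n => μ).withDensity
      fun x => ENNReal.ofReal (∏ i, p (x i))) := by
    rw [← pi_density hp hp0]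
    infer_instance
  rw [pi_density hp hp0, pi_density hq fun x => (hq0 x).le]
  exact half_le_withDensity_add_compl (by fun_prop) (by fun_prop)
    (fun x => Finset.prod_pos fun i _ => hq0 _) hchi hA

lemma chiSqMoment_le_one_add (hp : Integrable p μ) (hq : Integrable q μ)
    (hp1 : ∫ x, p x ∂μ = 1) (hq1 : ∫ x, q x ∂μ = 1)
    (hpq : Integrable (fun x => (p x - q x) ^ 2) μ) {m : ℝ} (hm : 0 < m) (hmq : ∀ x, m ≤ q x) :
    chiSqMoment μ p q ≤ ENNReal.ofReal (1 + m⁻¹ * ∫ x, (p x - q x) ^ 2 ∂μ) := by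
  have hq0 (x : Ω) : 0 < q x := hm.trans_le (hmq x)
  have ratio_le (x : Ω) : p x ^ 2 / q x ≤ 2 * p x - q x + m⁻¹ * (p x - q x) ^ 2 := by
    have hexpand : p x ^ 2 / q x = 2 * p x - q x + (q x)⁻¹ * (p x - q x) ^ 2 := by
      have := (hq0 x).ne'
      field_simp
      ring
    have := mul_le_mul_of_nonneg_right (inv_anti₀ hm (hmq x)) (sq_nonneg (p x - q x))
    linarith
  have hbound : Integrable (fun x => 2 * p x - q x + m⁻¹ * (p x - q x) ^ 2) μ :=
    ((hp.const_mul 2).sub hq).add (hpq.const_mul _)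
  have hintegral : ∫ x, (2 * p x - q x + m⁻¹ * (p x - q x) ^ 2) ∂μ =
      1 + m⁻¹ * ∫ x, (p x - q x) ^ 2 ∂μ := by
    rw [integral_add (f := fun x => 2 * p x - q x) ((hp.const_mul 2).sub hq) (hpq.const_mul _),
      integral_sub (hp.const_mul 2) hq, integral_const_mul, integral_const_mul, hp1, hq1]
    norm_num
  rw [← hintegral, ofReal_integral_eq_lintegral_ofReal hbound
    (.of_forall fun x => (div_nonneg (sq_nonneg _) (hq0 x).le).trans (ratio_le x))]
  exact lintegral_mono fun x => ENNReal.ofReal_le_ofReal (ratio_le x)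

lemma ofReal_sq_integral_div_integral_le {f g : Ω → ℝ} (hf : Integrable f μ)
    (hg : Integrable g μ) (hg0 : ∀ x, 0 < g x) (hG : 0 < ∫ x, g x ∂μ) :
    ENNReal.ofReal ((∫ x, f x ∂μ) ^ 2 / ∫ x, g x ∂μ) ≤
      ∫⁻ x, ENNReal.ofReal (f x ^ 2 / g x) ∂μ := by
  set r := (∫ x, f x ∂μ) / ∫ x, g x ∂μ with hr
  -- The tangent line of `t ↦ t²` at `t = r`, evaluated at `t = f x / g x`.
  set ℓ : Ω → ℝ := fun x => 2 * r * f x - r ^ 2 * g x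
  have hℓ : Integrable ℓ μ := (hf.const_mul _).sub (hg.const_mul _)
  have tangent_le (x : Ω) : ℓ x ≤ f x ^ 2 / g x := by
    rw [le_div_iff₀ (hg0 x)]
    nlinarith [sq_nonneg (f x - r * g x)]
  have integral_tangent : ∫ x, ℓ x ∂μ = (∫ x, f x ∂μ) ^ 2 / ∫ x, g x ∂μ := by
    rw [integral_sub (hf.const_mul _) (hg.const_mul _), integral_const_mul, integral_const_mul, hr]
    field_simp
    ring
  calc ENNReal.ofReal ((∫ x, f x ∂μ) ^ 2 / ∫ x, g x ∂μ)
      ≤ ENNReal.ofReal (∫ x, max (ℓ x) 0 ∂μ) := by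
        rw [← integral_tangent]
        exact ENNReal.ofReal_le_ofReal (integral_mono hℓ hℓ.pos_part fun x => le_max_left _ _)
    _ = ∫⁻ x, ENNReal.ofReal (max (ℓ x) 0) ∂μ :=
        ofReal_integral_eq_lintegral_ofReal hℓ.pos_part (.of_forall fun x => le_max_right _ _)
    _ ≤ ∫⁻ x, ENNReal.ofReal (f x ^ 2 / g x) ∂μ := lintegral_mono fun x =>
        ENNReal.ofReal_le_ofReal (max_le (tangent_le x) (div_nonneg (sq_nonneg _) (hg0 x).le))

end ChiSquare

section GaussianTilt

variable {E : Type*} [NormedAddCommGroup E] [InnerProductSpace ℝ E]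

/-- The likelihood ratio at `y` of the standard Gaussian law shifted by `v` against the standard
Gaussian law. -/
def gaussianTilt (v y : E) : ℝ :=
  Real.exp (inner ℝ v y - ‖v‖ ^ 2 / 2)

lemma gaussianTilt_pos (v y : E) : 0 < gaussianTilt v y :=
  Real.exp_pos _

lemma continuous_gaussianTilt : Continuous fun z : E × E => gaussianTilt z.1 z.2 := by
  unfold gaussianTilt
  fun_prop

lemma gaussianTilt_le (v y : E) : gaussianTilt v y ≤ Real.exp (‖y‖ ^ 2 / 2) := by
  refine Real.exp_le_exp.2 ?_
  have := norm_sub_sq_real v y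
  linarith [sq_nonneg ‖v - y‖]

lemma gaussianTilt_mul (v w y : E) :
    gaussianTilt v y * gaussianTilt w y = Real.exp (inner ℝ v w) * gaussianTilt (v + w) y := by
  simp only [gaussianTilt, ← Real.exp_add]
  rw [norm_add_sq_real, inner_add_left]
  ring_nf

lemma gaussianTilt_sq_div (v w y : E) :
    gaussianTilt v y ^ 2 / gaussianTilt w y =
      Real.exp (‖v - w‖ ^ 2) * gaussianTilt ((2 : ℝ) • v - w) y := by
  simp only [gaussianTilt, ← Real.exp_nat_mul, ← Real.exp_sub, ← Real.exp_add]
  rw [norm_sub_sq_real, norm_sub_sq_real, inner_sub_left, real_inner_smul_left,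
    real_inner_smul_left, norm_smul, Real.norm_ofNat]
  push_cast
  ring_nf

lemma gaussianReal_eq_withDensity (c : ℝ) :
    gaussianReal c 1 =
      (gaussianReal 0 1).withDensity fun x => ENNReal.ofReal (Real.exp (c * x - c ^ 2 / 2)) := by
  rw [gaussianReal_of_var_ne_zero _ one_ne_zero, gaussianReal_of_var_ne_zero _ one_ne_zero,
    ← withDensity_mul _ (measurable_gaussianPDF 0 1) (by fun_prop)]
  congr 1
  ext x
  simp only [Pi.mul_apply, gaussianPDF, gaussianPDFReal]
  rw [← ENNReal.ofReal_mul (by positivity), mul_assoc _ _ (Real.exp (c * x - c ^ 2 / 2)),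
    ← Real.exp_add]
  congr 3
  push_cast
  ring

variable {ι : Type*} [Fintype ι]

lemma pi_gaussianReal_map_add_left (v : ι → ℝ) :
    (Measure.pi fun _ : ι => gaussianReal 0 1).map (fun x i => v i + x i) =
      (Measure.pi fun _ : ι => gaussianReal 0 1).withDensity
        fun x => ∏ i, ENNReal.ofReal (Real.exp (v i * x i - v i ^ 2 / 2)) := by
  have (i : ι) : SigmaFinite ((gaussianReal 0 1).withDensity
      fun x => ENNReal.ofReal (Real.exp (v i * x - v i ^ 2 / 2))) := by
    rw [← gaussianReal_eq_withDensity]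
    infer_instance
  rw [← pi_withDensity (fun _ : ι => gaussianReal 0 1)
    (f := fun i x => ENNReal.ofReal (Real.exp (v i * x - v i ^ 2 / 2))) fun i => by fun_prop]
  simp_rw [← gaussianReal_eq_withDensity]
  rw [Measure.pi_map_pi (f := fun i x => v i + x) fun i => by fun_prop]
  simp_rw [gaussianReal_map_const_add, zero_add]

lemma stdGaussian_map_add_left (v : EuclideanSpace ℝ ι) :
    (stdGaussian (EuclideanSpace ℝ ι)).map (fun y => v + y) =
      (stdGaussian (EuclideanSpace ℝ ι)).withDensity
        fun y => ENNReal.ofReal (gaussianTilt v y) := by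
  have hcomp : (fun y => v + y) ∘ (WithLp.toLp 2 : (ι → ℝ) → EuclideanSpace ℝ ι) =
      WithLp.toLp 2 ∘ fun x i => v i + x i := rfl
  have gaussianTilt_toLp (x : ι → ℝ) : ENNReal.ofReal (gaussianTilt v (WithLp.toLp 2 x)) =
      ∏ i, ENNReal.ofReal (Real.exp (v i * x i - v i ^ 2 / 2)) := by
    rw [← ENNReal.ofReal_prod_of_nonneg fun i _ => (Real.exp_pos _).le, ← Real.exp_sum,
      Finset.sum_sub_distrib, ← Finset.sum_div, ← EuclideanSpace.real_norm_sq_eq, gaussianTilt,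
      PiLp.inner_apply]
    simp_rw [Real.inner_apply]
  have hmeas : Measurable (gaussianTilt v) :=
    (continuous_gaussianTilt.comp (.prodMk_right v)).measurable
  rw [← map_pi_eq_stdGaussian, Measure.map_map (by fun_prop) (by fun_prop), hcomp,
    ← Measure.map_map (by fun_prop) (by fun_prop), pi_gaussianReal_map_add_left]
  ext s hs
  rw [Measure.map_apply (by fun_prop) hs, withDensity_apply _ hs,
    withDensity_apply _ (hs.preimage (by fun_prop)),
    setLIntegral_map hs (by fun_prop) (by fun_prop)]
  simp_rw [gaussianTilt_toLp]

lemma lintegral_gaussianTilt (v : EuclideanSpace ℝ ι) :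
    ∫⁻ y, ENNReal.ofReal (gaussianTilt v y) ∂(stdGaussian (EuclideanSpace ℝ ι)) = 1 := by
  rw [← setLIntegral_univ, ← withDensity_apply _ MeasurableSet.univ, ← stdGaussian_map_add_left,
    Measure.map_apply (by fun_prop) MeasurableSet.univ, Set.preimage_univ, measure_univ]

end GaussianTilt

section Mixture

variable {ι A B : Type*} [Fintype ι] [MeasurableSpace A] [MeasurableSpace B]

/-- The density, with respect to the standard Gaussian law, of the law of `v a + ε` with `a` drawn
from `ν` and `ε` an independent standard Gaussian vector. -/
def mixtureDensity (ν : Measure A) (v : A → EuclideanSpace ℝ ι) (y : EuclideanSpace ℝ ι) : ℝ :=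
  ∫ a, gaussianTilt (v a) y ∂ν

variable {ν : Measure A} {ν' : Measure B} [IsProbabilityMeasure ν] [IsProbabilityMeasure ν']
  {v w : A → EuclideanSpace ℝ ι} {u : B → EuclideanSpace ℝ ι}

lemma measurable_gaussianTilt_comp (hv : Measurable v) :
    Measurable fun z : A × EuclideanSpace ℝ ι => gaussianTilt (v z.1) z.2 :=
  continuous_gaussianTilt.measurable.comp ((hv.comp measurable_fst).prodMk measurable_snd)

lemma integrable_gaussianTilt (hv : Measurable v) (y : EuclideanSpace ℝ ι) :
    Integrable (fun a => gaussianTilt (v a) y) ν := by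
  refine Integrable.of_bound ((measurable_gaussianTilt_comp hv).comp
    measurable_prodMk_right).aestronglyMeasurable (Real.exp (‖y‖ ^ 2 / 2)) (.of_forall fun a => ?_)
  rw [Real.norm_of_nonneg (gaussianTilt_pos _ _).le]
  exact gaussianTilt_le _ _

lemma mixtureDensity_pos (hv : Measurable v) (y : EuclideanSpace ℝ ι) :
    0 < mixtureDensity ν v y :=
  integral_exp_pos (integrable_gaussianTilt hv y)

lemma measurable_mixtureDensity (hv : Measurable v) : Measurable (mixtureDensity ν v) :=
  (measurable_gaussianTilt_comp hv).stronglyMeasurable.integral_prod_left'.measurable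

lemma ofReal_mixtureDensity (hv : Measurable v) (y : EuclideanSpace ℝ ι) :
    ENNReal.ofReal (mixtureDensity ν v y) = ∫⁻ a, ENNReal.ofReal (gaussianTilt (v a) y) ∂ν :=
  ofReal_integral_eq_lintegral_ofReal (integrable_gaussianTilt hv y)
    (.of_forall fun _ => (gaussianTilt_pos _ _).le)

lemma map_add_eq_withDensity_mixtureDensity (hv : Measurable v) :
    (ν.prod (stdGaussian (EuclideanSpace ℝ ι))).map (fun z => v z.1 + z.2) =
      (stdGaussian (EuclideanSpace ℝ ι)).withDensity
        fun y => ENNReal.ofReal (mixtureDensity ν v y) := by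
  have hadd : Measurable fun z : A × EuclideanSpace ℝ ι => v z.1 + z.2 := by fun_prop
  ext s hs
  rw [Measure.map_apply hadd hs, Measure.prod_apply (hs.preimage hadd), withDensity_apply _ hs]
  simp_rw [ofReal_mixtureDensity hv]
  rw [lintegral_lintegral_swap
    ((measurable_gaussianTilt_comp hv).comp measurable_swap).ennreal_ofReal.aemeasurable]
  refine lintegral_congr fun a => ?_
  rw [← withDensity_apply _ hs, ← stdGaussian_map_add_left, Measure.map_apply (by fun_prop) hs]
  rfl

lemma lintegral_mixtureDensity (hv : Measurable v) :
    ∫⁻ y, ENNReal.ofReal (mixtureDensity ν v y) ∂(stdGaussian (EuclideanSpace ℝ ι)) = 1 := by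
  rw [← setLIntegral_univ, ← withDensity_apply _ MeasurableSet.univ,
    ← map_add_eq_withDensity_mixtureDensity hv, Measure.map_apply (by fun_prop) MeasurableSet.univ,
    Set.preimage_univ, measure_univ]

lemma integrable_mixtureDensity (hv : Measurable v) :
    Integrable (mixtureDensity ν v) (stdGaussian (EuclideanSpace ℝ ι)) := by
  rw [← lintegral_ofReal_ne_top_iff_integrable
    (measurable_mixtureDensity hv).aestronglyMeasurable
    (.of_forall fun y => (mixtureDensity_pos hv y).le), lintegral_mixtureDensity hv]
  exact ENNReal.one_ne_top

lemma integral_mixtureDensity (hv : Measurable v) :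
    ∫ y, mixtureDensity ν v y ∂(stdGaussian (EuclideanSpace ℝ ι)) = 1 := by
  rw [integral_eq_lintegral_of_nonneg_ae (.of_forall fun y => (mixtureDensity_pos hv y).le)
    (measurable_mixtureDensity hv).aestronglyMeasurable, lintegral_mixtureDensity hv,
    ENNReal.toReal_one]

lemma lintegral_mixtureDensity_mul (hv : Measurable v) (hu : Measurable u) :
    ∫⁻ y, ENNReal.ofReal (mixtureDensity ν v y * mixtureDensity ν' u y)
        ∂(stdGaussian (EuclideanSpace ℝ ι)) =
      ∫⁻ z, ENNReal.ofReal (Real.exp (inner ℝ (v z.1) (u z.2))) ∂(ν.prod ν') := by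
  have hsum : Measurable fun z : A × B => v z.1 + u z.2 := by fun_prop
  have ofReal_mul (y : EuclideanSpace ℝ ι) :
      ENNReal.ofReal (mixtureDensity ν v y * mixtureDensity ν' u y) =
        ∫⁻ z, ENNReal.ofReal (Real.exp (inner ℝ (v z.1) (u z.2))) *
          ENNReal.ofReal (gaussianTilt (v z.1 + u z.2) y) ∂(ν.prod ν') := by
    rw [ENNReal.ofReal_mul (mixtureDensity_pos hv y).le, ofReal_mixtureDensity hv,
      ofReal_mixtureDensity hu, ← lintegral_prod_mul
        (integrable_gaussianTilt hv y).aemeasurable.ennreal_ofReal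
        (integrable_gaussianTilt hu y).aemeasurable.ennreal_ofReal]
    simp_rw [← ENNReal.ofReal_mul (gaussianTilt_pos _ _).le, gaussianTilt_mul,
      ENNReal.ofReal_mul (Real.exp_pos _).le]
  simp_rw [ofReal_mul]
  rw [lintegral_lintegral_swap]
  · refine lintegral_congr fun z => ?_
    rw [lintegral_const_mul' _ _ ENNReal.ofReal_ne_top, lintegral_gaussianTilt, mul_one]
  · have := (measurable_gaussianTilt_comp hsum).comp measurable_swap
    exact Measurable.aemeasurable (.mul (by fun_prop) this.ennreal_ofReal)

lemma integrable_mixtureDensity_mul (hv : Measurable v) (hu : Measurable u)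
    (hvu : Integrable (fun z : A × B => Real.exp (inner ℝ (v z.1) (u z.2))) (ν.prod ν')) :
    Integrable (fun y => mixtureDensity ν v y * mixtureDensity ν' u y)
      (stdGaussian (EuclideanSpace ℝ ι)) := by
  refine (lintegral_ofReal_ne_top_iff_integrable
    ((measurable_mixtureDensity hv).mul (measurable_mixtureDensity hu)).aestronglyMeasurable
    (.of_forall fun y => (mul_pos (mixtureDensity_pos hv y) (mixtureDensity_pos hu y)).le)).1 ?_
  exact (lintegral_mixtureDensity_mul hv hu).trans_ne hvu.lintegral_lt_top.ne

lemma integral_mixtureDensity_mul (hv : Measurable v) (hu : Measurable u) :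
    ∫ y, mixtureDensity ν v y * mixtureDensity ν' u y ∂(stdGaussian (EuclideanSpace ℝ ι)) =
      ∫ z, Real.exp (inner ℝ (v z.1) (u z.2)) ∂(ν.prod ν') := by
  rw [integral_eq_lintegral_of_nonneg_ae
    (.of_forall fun y => (mul_pos (mixtureDensity_pos hv y) (mixtureDensity_pos hu y)).le)
    ((measurable_mixtureDensity hv).mul (measurable_mixtureDensity hu)).aestronglyMeasurable,
    lintegral_mixtureDensity_mul hv hu, ← integral_eq_lintegral_of_nonneg_ae
    (.of_forall fun z => (Real.exp_pos _).le) (by fun_prop)]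

lemma chiSqMoment_mixtureDensity_le (hv : Measurable v) (hw : Measurable w) :
    chiSqMoment (stdGaussian (EuclideanSpace ℝ ι)) (mixtureDensity ν v) (mixtureDensity ν w) ≤
      ∫⁻ a, ENNReal.ofReal (Real.exp (‖v a - w a‖ ^ 2)) ∂ν := by
  have hdiff : Measurable fun a => (2 : ℝ) • v a - w a := by fun_prop
  calc chiSqMoment (stdGaussian _) (mixtureDensity ν v) (mixtureDensity ν w)
      ≤ ∫⁻ y, ∫⁻ a, ENNReal.ofReal (gaussianTilt (v a) y ^ 2 / gaussianTilt (w a) y) ∂ν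
          ∂(stdGaussian _) :=
        lintegral_mono fun y => ofReal_sq_integral_div_integral_le (integrable_gaussianTilt hv y)
          (integrable_gaussianTilt hw y) (fun a => gaussianTilt_pos _ _) (mixtureDensity_pos hw y)
    _ = ∫⁻ y, ∫⁻ a, ENNReal.ofReal (Real.exp (‖v a - w a‖ ^ 2)) *
          ENNReal.ofReal (gaussianTilt ((2 : ℝ) • v a - w a) y) ∂ν ∂(stdGaussian _) := by
        simp_rw [gaussianTilt_sq_div, ENNReal.ofReal_mul (Real.exp_pos _).le]
    _ = ∫⁻ a, ∫⁻ y, ENNReal.ofReal (Real.exp (‖v a - w a‖ ^ 2)) *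
          ENNReal.ofReal (gaussianTilt ((2 : ℝ) • v a - w a) y) ∂(stdGaussian _) ∂ν := by
        have := (measurable_gaussianTilt_comp hdiff).comp measurable_swap
        exact lintegral_lintegral_swap
          (Measurable.aemeasurable (.mul (by fun_prop) this.ennreal_ofReal))
    _ = ∫⁻ a, ENNReal.ofReal (Real.exp (‖v a - w a‖ ^ 2)) ∂ν := by
        refine lintegral_congr fun a => ?_
        rw [lintegral_const_mul' _ _ ENNReal.ofReal_ne_top, lintegral_gaussianTilt, mul_one]

lemma exp_integral_le_mixtureDensity (hv : Measurable v) (y : EuclideanSpace ℝ ι)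
    (hint : Integrable (fun a => inner ℝ (v a) y - ‖v a‖ ^ 2 / 2) ν) :
    Real.exp (∫ a, (inner ℝ (v a) y - ‖v a‖ ^ 2 / 2) ∂ν) ≤ mixtureDensity ν v y :=
  convexOn_exp.map_integral_le Real.continuous_exp.continuousOn isClosed_univ
    (.of_forall fun _ => Set.mem_univ _) hint (integrable_gaussianTilt hv y)

end Mixture

section UniformAngle

lemma integrable_unifAngle {f : ℝ → ℝ} (hf : Continuous f) : Integrable f unifAngle := by
  have h : IntegrableOn f (Set.Ico (-Real.pi) Real.pi) :=
    (hf.integrableOn_Icc (a := -Real.pi) (b := Real.pi)).mono_set Set.Ico_subset_Icc_self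
  refine Integrable.smul_measure h ?_
  simp [Real.volume_Ico, Real.pi_pos]

lemma integral_unifAngle (f : ℝ → ℝ) :
    ∫ α, f α ∂unifAngle = (2 * Real.pi)⁻¹ * ∫ α in (-Real.pi)..Real.pi, f α := by
  unfold unifAngle ProbabilityTheory.cond
  rw [integral_smul_measure, Real.volume_Ico,
    intervalIntegral.integral_of_le (by linarith [Real.pi_pos]), integral_Ico_eq_integral_Ioo,
    integral_Ioc_eq_integral_Ioo, smul_eq_mul, ENNReal.toReal_inv,
    ENNReal.toReal_ofReal (by linarith [Real.pi_pos]), sub_neg_eq_add, two_mul]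

lemma integral_unifAngle_add {f : ℝ → ℝ} (hf : Function.Periodic f (2 * Real.pi)) (c : ℝ) :
    ∫ α, f (α + c) ∂unifAngle = ∫ α, f α ∂unifAngle := by
  have hshift := hf.intervalIntegral_add_eq (-Real.pi + c) (-Real.pi)
  rw [show -Real.pi + c + 2 * Real.pi = Real.pi + c by ring,
    show -Real.pi + 2 * Real.pi = Real.pi by ring] at hshift
  rw [integral_unifAngle, integral_unifAngle, intervalIntegral.integral_comp_add_right, hshift]

lemma integral_unifAngle_cos {k : ℤ} (hk : k ≠ 0) (c : ℝ) :
    ∫ α, Real.cos (k * α + c) ∂unifAngle = 0 := by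
  rw [integral_unifAngle, intervalIntegral.integral_comp_mul_add _ (Int.cast_ne_zero.2 hk),
    integral_cos, show (k : ℝ) * Real.pi + c = k * -Real.pi + c + k * (2 * Real.pi) by ring,
    Real.sin_add_int_mul_two_pi, sub_self, smul_zero, mul_zero]

lemma integral_unifAngle_cos_mul_cos {k l : ℕ} (hkl : k ≠ l) :
    ∫ α, Real.cos (k * α) * Real.cos (l * α) ∂unifAngle = 0 := by
  have product_to_sum (α : ℝ) : Real.cos (k * α) * Real.cos (l * α) =
      1 / 2 * (Real.cos ((k - l : ℤ) * α + 0) + Real.cos ((k + l : ℤ) * α + 0)) := by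
    push_cast
    rw [add_zero, add_zero, sub_mul, add_mul, Real.cos_sub, Real.cos_add]
    ring
  simp_rw [product_to_sum]
  rw [integral_const_mul, integral_add (integrable_unifAngle (by fun_prop))
    (integrable_unifAngle (by fun_prop)), integral_unifAngle_cos (by omega),
    integral_unifAngle_cos (by omega), add_zero, mul_zero]

end UniformAngle

variable {K : ℕ}

section Rotation

lemma rotate_apply_zero (α : ℝ) (θ : Coeff K) (k : Fin K) :
    rotate α θ (k, 0) = Real.cos (((k : ℕ) + 1) * α) * θ (k, 0) -
      Real.sin (((k : ℕ) + 1) * α) * θ (k, 1) := by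
  simp [rotate, Matrix.mulVec, dotProduct, sub_eq_add_neg]

lemma rotate_apply_one (α : ℝ) (θ : Coeff K) (k : Fin K) :
    rotate α θ (k, 1) = Real.sin (((k : ℕ) + 1) * α) * θ (k, 0) +
      Real.cos (((k : ℕ) + 1) * α) * θ (k, 1) := by
  simp [rotate, Matrix.mulVec, dotProduct]

lemma coeff_ext {θ θ' : Coeff K} (h0 : ∀ k, θ (k, 0) = θ' (k, 0))
    (h1 : ∀ k, θ (k, 1) = θ' (k, 1)) : θ = θ' := by
  ext ⟨k, i⟩
  fin_cases i
  exacts [h0 k, h1 k]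

lemma inner_coeff (θ θ' : Coeff K) :
    inner ℝ θ θ' = ∑ k, (θ (k, 0) * θ' (k, 0) + θ (k, 1) * θ' (k, 1)) := by
  rw [PiLp.inner_apply, Fintype.sum_prod_type]
  simp only [Fin.sum_univ_two, Real.inner_apply]

lemma rotate_rotate (α β : ℝ) (θ : Coeff K) : rotate α (rotate β θ) = rotate (α + β) θ := by
  refine coeff_ext (fun k => ?_) fun k => ?_
  · simp only [rotate_apply_zero, rotate_apply_one, mul_add, Real.cos_add, Real.sin_add]
    ring
  · simp only [rotate_apply_zero, rotate_apply_one, mul_add, Real.cos_add, Real.sin_add]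
    ring

lemma rotate_periodic (θ : Coeff K) : Function.Periodic (fun α => rotate α θ) (2 * Real.pi) := by
  intro α
  have angle_add (k : ℕ) :
      ((k : ℝ) + 1) * (α + 2 * Real.pi) = (k + 1) * α + (k + 1 : ℕ) * (2 * Real.pi) := by
    push_cast
    ring
  refine coeff_ext (fun k => ?_) fun k => ?_ <;>
    simp only [rotate_apply_zero, rotate_apply_one, angle_add, Real.cos_add_nat_mul_two_pi,
      Real.sin_add_nat_mul_two_pi]

lemma rotate_sub (α : ℝ) (θ θ' : Coeff K) : rotate α (θ - θ') = rotate α θ - rotate α θ' := by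
  refine coeff_ext (fun k => ?_) fun k => ?_ <;>
    simp only [rotate_apply_zero, rotate_apply_one, PiLp.sub_apply] <;> ring

lemma rotate_smul (α c : ℝ) (θ : Coeff K) : rotate α (c • θ) = c • rotate α θ := by
  refine coeff_ext (fun k => ?_) fun k => ?_ <;>
    simp only [rotate_apply_zero, rotate_apply_one, PiLp.smul_apply, smul_eq_mul] <;> ring

lemma inner_rotate_rotate_self (α : ℝ) (θ θ' : Coeff K) :
    inner ℝ (rotate α θ) (rotate α θ') = inner ℝ θ θ' := by
  rw [inner_coeff, inner_coeff]
  refine Finset.sum_congr rfl fun k _ => ?_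
  rw [rotate_apply_zero, rotate_apply_zero, rotate_apply_one, rotate_apply_one]
  linear_combination (θ (k, 0) * θ' (k, 0) + θ (k, 1) * θ' (k, 1)) *
    Real.sin_sq_add_cos_sq (((k : ℕ) + 1) * α)

lemma inner_rotate_rotate (α β : ℝ) (θ θ' : Coeff K) :
    inner ℝ (rotate α θ) (rotate β θ') = inner ℝ (rotate (α - β) θ) θ' := by
  rw [← inner_rotate_rotate_self β (rotate (α - β) θ), rotate_rotate, add_sub_cancel]

lemma norm_rotate (α : ℝ) (θ : Coeff K) : ‖rotate α θ‖ = ‖θ‖ := by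
  rw [norm_eq_sqrt_real_inner, inner_rotate_rotate_self, ← norm_eq_sqrt_real_inner]

lemma continuous_rotate (α : ℝ) : Continuous (rotate α : Coeff K → Coeff K) :=
  (LipschitzWith.of_dist_le_mul (K := 1) fun θ θ' => by
    rw [dist_eq_norm, ← rotate_sub, norm_rotate, dist_eq_norm, NNReal.coe_one,
      one_mul]).continuous

lemma continuous_rotate_angle (θ : Coeff K) : Continuous fun α => rotate α θ := by
  refine (PiLp.continuous_toLp 2 _).comp (continuous_pi fun p => ?_)
  obtain ⟨k, i⟩ := p
  fin_cases i <;>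
    simp only [Matrix.mulVec, dotProduct, Fin.sum_univ_two, Matrix.of_apply, Matrix.cons_val] <;>
    fun_prop

lemma inner_rotate (α : ℝ) (θ y : Coeff K) :
    inner ℝ (rotate α θ) y = ∑ k : Fin K,
      ((θ (k, 0) * y (k, 0) + θ (k, 1) * y (k, 1)) * Real.cos ((k + 1 : ℤ) * α + 0) +
        (θ (k, 0) * y (k, 1) - θ (k, 1) * y (k, 0)) *
          Real.cos ((k + 1 : ℤ) * α + -(Real.pi / 2))) := by
  rw [inner_coeff]
  refine Finset.sum_congr rfl fun k _ => ?_
  push_cast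
  rw [rotate_apply_zero, rotate_apply_one, add_zero, ← sub_eq_add_neg, Real.cos_sub_pi_div_two]
  ring

lemma integral_inner_rotate (θ y : Coeff K) : ∫ α, inner ℝ (rotate α θ) y ∂unifAngle = 0 := by
  simp_rw [inner_rotate]
  rw [integral_finsetSum _ fun k _ => integrable_unifAngle (by fun_prop)]
  refine Finset.sum_eq_zero fun k _ => ?_
  rw [integral_add (integrable_unifAngle (by fun_prop)) (integrable_unifAngle (by fun_prop)),
    integral_const_mul, integral_const_mul, integral_unifAngle_cos (by omega),
    integral_unifAngle_cos (by omega), mul_zero, mul_zero, add_zero]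

end Rotation

section OrbitDensity

/-- The density of one observation of `θ` at noise level `1`, with respect to the law of the
noise. -/
def orbitDensity (θ : Coeff K) : Coeff K → ℝ :=
  mixtureDensity unifAngle fun α => rotate α θ

lemma measurable_rotate_angle (θ : Coeff K) : Measurable fun α => rotate α θ :=
  (continuous_rotate_angle θ).measurable

lemma measurable_orbitDensity (θ : Coeff K) : Measurable (orbitDensity θ) :=
  measurable_mixtureDensity (measurable_rotate_angle θ)

lemma orbitDensity_pos (θ y : Coeff K) : 0 < orbitDensity θ y :=
  mixtureDensity_pos (measurable_rotate_angle θ) y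

lemma exp_neg_le_orbitDensity (θ y : Coeff K) : Real.exp (-(‖θ‖ ^ 2 / 2)) ≤ orbitDensity θ y := by
  have hcont := continuous_rotate_angle θ
  have h := exp_integral_le_mixtureDensity (ν := unifAngle) (measurable_rotate_angle θ) y
    (integrable_unifAngle (by fun_prop))
  simp_rw [norm_rotate] at h
  rwa [integral_sub (integrable_unifAngle (by fun_prop)) (integrable_const _),
    integral_inner_rotate, integral_const, probReal_univ, one_smul, zero_sub] at h

lemma chiSqMoment_orbitDensity_le (θ θ' : Coeff K) :
    chiSqMoment (stdGaussian (Coeff K)) (orbitDensity θ) (orbitDensity θ') ≤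
      ENNReal.ofReal (Real.exp (‖θ - θ'‖ ^ 2)) := by
  refine (chiSqMoment_mixtureDensity_le (measurable_rotate_angle θ)
    (measurable_rotate_angle θ')).trans_eq ?_
  simp_rw [← rotate_sub, norm_rotate]
  rw [lintegral_const, measure_univ, mul_one]

lemma integrable_exp_inner_rotate_rotate (θ θ' : Coeff K) :
    Integrable (fun z : ℝ × ℝ => Real.exp (inner ℝ (rotate z.1 θ) (rotate z.2 θ')))
      (unifAngle.prod unifAngle) := by
  have hθ := measurable_rotate_angle θ
  have hθ' := measurable_rotate_angle θ'
  refine Integrable.of_bound (by fun_prop) (Real.exp (‖θ‖ * ‖θ'‖)) (.of_forall fun z => ?_)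
  rw [Real.norm_of_nonneg (Real.exp_nonneg _), Real.exp_le_exp]
  simpa only [norm_rotate] using real_inner_le_norm (rotate z.1 θ) (rotate z.2 θ')

lemma integrable_orbitDensity_mul (θ θ' : Coeff K) :
    Integrable (fun y => orbitDensity θ y * orbitDensity θ' y) (stdGaussian (Coeff K)) :=
  integrable_mixtureDensity_mul (measurable_rotate_angle θ) (measurable_rotate_angle θ')
    (integrable_exp_inner_rotate_rotate θ θ')

lemma integral_orbitDensity_mul (θ θ' : Coeff K) :
    ∫ y, orbitDensity θ y * orbitDensity θ' y ∂(stdGaussian (Coeff K)) =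
      ∫ α, Real.exp (inner ℝ (rotate α θ) θ') ∂unifAngle := by
  have hper : Function.Periodic (fun α => Real.exp (inner ℝ (rotate α θ) θ')) (2 * Real.pi) :=
    fun α => congrArg (fun v => Real.exp (inner ℝ v θ')) (rotate_periodic θ α)
  calc ∫ y, orbitDensity θ y * orbitDensity θ' y ∂(stdGaussian (Coeff K))
      = ∫ z, Real.exp (inner ℝ (rotate z.1 θ) (rotate z.2 θ')) ∂(unifAngle.prod unifAngle) :=
        integral_mixtureDensity_mul (measurable_rotate_angle θ) (measurable_rotate_angle θ')
    _ = ∫ β, ∫ α, Real.exp (inner ℝ (rotate (α + -β) θ) θ') ∂unifAngle ∂unifAngle := by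
        rw [integral_prod_symm _ (integrable_exp_inner_rotate_rotate θ θ')]
        simp_rw [inner_rotate_rotate, sub_eq_add_neg]
    _ = ∫ α, Real.exp (inner ℝ (rotate α θ) θ') ∂unifAngle := by
        simp_rw [integral_unifAngle_add hper]
        rw [integral_const, probReal_univ, one_smul]

lemma integral_orbitDensity_sub_sq (θ θ' : Coeff K) :
    ∫ y, (orbitDensity θ y - orbitDensity θ' y) ^ 2 ∂(stdGaussian (Coeff K)) =
      ∫ α, (Real.exp (inner ℝ (rotate α θ) θ) + Real.exp (inner ℝ (rotate α θ') θ') -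
        (Real.exp (inner ℝ (rotate α θ) θ') + Real.exp (inner ℝ (rotate α θ') θ))) ∂unifAngle := by
  have hθ := continuous_rotate_angle θ
  have hθ' := continuous_rotate_angle θ'
  have expand (y : Coeff K) : (orbitDensity θ y - orbitDensity θ' y) ^ 2 =
      orbitDensity θ y * orbitDensity θ y + orbitDensity θ' y * orbitDensity θ' y -
        (orbitDensity θ y * orbitDensity θ' y + orbitDensity θ' y * orbitDensity θ y) := by ring
  have hint (a b a' b' : Coeff K) : Integrable (fun y => orbitDensity a y * orbitDensity b y +
      orbitDensity a' y * orbitDensity b' y) (stdGaussian (Coeff K)) :=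
    (integrable_orbitDensity_mul a b).add (integrable_orbitDensity_mul a' b')
  simp_rw [expand]
  rw [integral_sub (hint _ _ _ _) (hint _ _ _ _), integral_sub, integral_add, integral_add,
    integral_add, integral_add] <;>
  first
  | exact integrable_orbitDensity_mul _ _
  | exact integrable_unifAngle (by fun_prop)
  | simp only [integral_orbitDensity_mul]

lemma integrable_orbitDensity_sub_sq (θ θ' : Coeff K) :
    Integrable (fun y => (orbitDensity θ y - orbitDensity θ' y) ^ 2) (stdGaussian (Coeff K)) := by
  refine (((integrable_orbitDensity_mul θ θ).add (integrable_orbitDensity_mul θ' θ')).sub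
    ((integrable_orbitDensity_mul θ θ').const_mul 2)).congr (.of_forall fun y => ?_)
  simp only [Pi.add_apply, Pi.sub_apply]
  ring

lemma chiSqMoment_orbitDensity_le_one_add (θ θ' : Coeff K) :
    chiSqMoment (stdGaussian (Coeff K)) (orbitDensity θ) (orbitDensity θ') ≤
      ENNReal.ofReal (1 + Real.exp (‖θ'‖ ^ 2 / 2) *
        ∫ α, (Real.exp (inner ℝ (rotate α θ) θ) + Real.exp (inner ℝ (rotate α θ') θ') -
          (Real.exp (inner ℝ (rotate α θ) θ') + Real.exp (inner ℝ (rotate α θ') θ)))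
            ∂unifAngle) := by
  rw [← integral_orbitDensity_sub_sq]
  have h := chiSqMoment_le_one_add (integrable_mixtureDensity (measurable_rotate_angle θ))
    (integrable_mixtureDensity (measurable_rotate_angle θ'))
    (integral_mixtureDensity (measurable_rotate_angle θ))
    (integral_mixtureDensity (measurable_rotate_angle θ'))
    (integrable_orbitDensity_sub_sq θ θ') (Real.exp_pos _) (exp_neg_le_orbitDensity θ')
  rwa [← Real.exp_neg, neg_neg] at h

lemma sampleLaw_eq_map {σ : ℝ} (hσ : σ ≠ 0) (θ : Coeff K) :
    sampleLaw σ θ = ((stdGaussian (Coeff K)).withDensity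
      fun y => ENNReal.ofReal (orbitDensity (σ⁻¹ • θ) y)).map fun y => σ • y := by
  have hrotate := measurable_rotate_angle (σ⁻¹ • θ)
  have hscale (z : ℝ × Coeff K) :
      rotate z.1 θ + σ • z.2 = σ • (rotate z.1 (σ⁻¹ • θ) + z.2) := by
    rw [smul_add, ← rotate_smul, smul_inv_smul₀ hσ]
  simp_rw [sampleLaw, hscale]
  exact (Measure.map_map (by fun_prop) (by fun_prop)).symm.trans <| congrArg _ <|
    map_add_eq_withDensity_mixtureDensity hrotate

instance (θ : Coeff K) : IsProbabilityMeasure ((stdGaussian (Coeff K)).withDensity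
    fun y => ENNReal.ofReal (orbitDensity θ y)) where
  measure_univ := by
    rw [withDensity_apply _ MeasurableSet.univ, setLIntegral_univ]
    exact lintegral_mixtureDensity (measurable_rotate_angle θ)

lemma half_le_dataLaw_add_compl {N : ℕ} {σ x : ℝ} (hσ : σ ≠ 0) (hx : N * x ≤ 1 / 2)
    {θ θ' : Coeff K} (hθ : chiSqMoment (stdGaussian (Coeff K)) (orbitDensity (σ⁻¹ • θ))
      (orbitDensity (σ⁻¹ • θ')) ≤ ENNReal.ofReal (Real.exp x))
    {A : Set (Fin N → Coeff K)} (hA : MeasurableSet A) :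
    1 / 2 ≤ dataLaw N σ θ' A + dataLaw N σ θ Aᶜ := by
  have hscale : Measurable fun (y : Fin N → Coeff K) i => σ • y i := by fun_prop
  have dataLaw_eq_map (θ : Coeff K) : dataLaw N σ θ =
      (Measure.pi fun _ : Fin N => (stdGaussian (Coeff K)).withDensity
        fun y => ENNReal.ofReal (orbitDensity (σ⁻¹ • θ) y)).map fun y i => σ • y i := by
    rw [Measure.pi_map_pi (f := fun _ y => σ • y) fun _ => by fun_prop, dataLaw,
      sampleLaw_eq_map hσ]
  rw [dataLaw_eq_map, dataLaw_eq_map, Measure.map_apply hscale hA,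
    Measure.map_apply hscale hA.compl, Set.preimage_compl]
  exact half_le_pi_withDensity_add_compl (measurable_orbitDensity _)
    (fun y => (orbitDensity_pos _ y).le) (measurable_orbitDensity _) (orbitDensity_pos _) hx hθ
    (hA.preimage hscale)

end OrbitDensity

section Chord

/-- The squared length `|e ^ (i x) - 1| ^ 2` of the chord of angle `x` in the unit circle. -/
def chordSq (x : ℝ) : ℝ :=
  2 - 2 * Real.cos x

lemma chordSq_nonneg (x : ℝ) : 0 ≤ chordSq x :=
  sub_nonneg.2 (by linarith [Real.cos_le_one x])

lemma chordSq_zero : chordSq 0 = 0 := by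
  simp [chordSq]

lemma chordSq_neg (x : ℝ) : chordSq (-x) = chordSq x := by
  rw [chordSq, chordSq, Real.cos_neg]

lemma chordSq_le_sq (x : ℝ) : chordSq x ≤ x ^ 2 := by
  unfold chordSq
  linarith [Real.one_sub_sq_div_two_le_cos (x := x)]

lemma two_fifths_mul_sq_le_chordSq {x : ℝ} (hx : x ^ 2 ≤ 1) : 2 / 5 * x ^ 2 ≤ chordSq x := by
  have hx' : |x| ≤ 1 := (sq_le_one_iff_abs_le_one x).1 hx
  have hcos := Real.cos_le_one_sub_mul_cos_sq (hx'.trans (by linarith [Real.pi_gt_three]))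
  have hπ : Real.pi ^ 2 ≤ 10 := by nlinarith [Real.pi_lt_d2, Real.pi_pos]
  have h : 1 / 5 ≤ 2 / Real.pi ^ 2 := by
    rw [div_le_div_iff₀ (by norm_num) (by positivity)]
    linarith
  unfold chordSq
  nlinarith [sq_nonneg x]

lemma chordSq_eq_four_mul_sin_sq (x : ℝ) : chordSq x = 4 * Real.sin (x / 2) ^ 2 := by
  have h := Real.cos_two_mul (x / 2)
  rw [mul_div_cancel₀ x two_ne_zero, Real.cos_sq'] at h
  rw [chordSq, h]
  ring

lemma chordSq_add_le (x y : ℝ) : chordSq (x + y) ≤ 2 * chordSq x + 2 * chordSq y := by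
  have hsin : |Real.sin ((x + y) / 2)| ≤ |Real.sin (x / 2)| + |Real.sin (y / 2)| := by
    rw [add_div, Real.sin_add]
    refine (abs_add_le _ _).trans (add_le_add ?_ ?_) <;> rw [abs_mul]
    · exact mul_le_of_le_one_right (abs_nonneg _) (Real.abs_cos_le_one _)
    · exact mul_le_of_le_one_left (abs_nonneg _) (Real.abs_cos_le_one _)
  have hsq := (pow_le_pow_left₀ (abs_nonneg _) hsin 2).trans add_sq_le
  rw [sq_abs, sq_abs, sq_abs] at hsq
  rw [chordSq_eq_four_mul_sin_sq, chordSq_eq_four_mul_sin_sq, chordSq_eq_four_mul_sin_sq]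
  linarith

end Chord

section Signal

/-- The element of `paramSpace K s` whose `k`-th coefficient pair has phase `φ k`. -/
def signal (s : ℝ) (φ : Fin K → ℝ) : Coeff K :=
  WithLp.toLp 2 fun p => s * ![Real.cos (φ p.1), Real.sin (φ p.1)] p.2

lemma signal_apply_zero (s : ℝ) (φ : Fin K → ℝ) (k : Fin K) :
    signal s φ (k, 0) = s * Real.cos (φ k) := rfl

lemma signal_apply_one (s : ℝ) (φ : Fin K → ℝ) (k : Fin K) :
    signal s φ (k, 1) = s * Real.sin (φ k) := rfl

lemma smul_signal (c s : ℝ) (φ : Fin K → ℝ) : c • signal s φ = signal (c * s) φ :=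
  coeff_ext (fun _ => (mul_assoc _ _ _).symm) fun _ => (mul_assoc _ _ _).symm

lemma signal_mem_paramSpace {s : ℝ} (hs : 0 ≤ s) (φ : Fin K → ℝ) :
    signal s φ ∈ paramSpace K s := by
  intro k
  rw [magnitude, signal_apply_zero, signal_apply_one, mul_pow, mul_pow, ← mul_add,
    Real.cos_sq_add_sin_sq, mul_one, Real.sqrt_sq hs]

lemma rotate_signal (α s : ℝ) (φ : Fin K → ℝ) :
    rotate α (signal s φ) = signal s fun k => φ k + ((k : ℕ) + 1) * α := by
  refine coeff_ext (fun k => ?_) fun k => ?_ <;>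
    simp only [rotate_apply_zero, rotate_apply_one, signal_apply_zero, signal_apply_one,
      Real.cos_add, Real.sin_add] <;> ring

lemma inner_signal (s : ℝ) (φ ψ : Fin K → ℝ) :
    inner ℝ (signal s φ) (signal s ψ) = s ^ 2 * ∑ k, Real.cos (φ k - ψ k) := by
  rw [inner_coeff, Finset.mul_sum]
  refine Finset.sum_congr rfl fun k _ => ?_
  rw [signal_apply_zero, signal_apply_zero, signal_apply_one, signal_apply_one, Real.cos_sub]
  ring

lemma norm_signal_sq (s : ℝ) (φ : Fin K → ℝ) : ‖signal s φ‖ ^ 2 = K * s ^ 2 := by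
  rw [← real_inner_self_eq_norm_sq, inner_signal]
  simp [mul_comm]

lemma norm_signal_sub_sq (s : ℝ) (φ ψ : Fin K → ℝ) :
    ‖signal s φ - signal s ψ‖ ^ 2 = s ^ 2 * ∑ k, chordSq (φ k - ψ k) := by
  unfold chordSq
  rw [norm_sub_sq_real, norm_signal_sq, norm_signal_sq, inner_signal, Finset.sum_sub_distrib,
    ← Finset.mul_sum, Finset.sum_const, Finset.card_univ, Fintype.card_fin, nsmul_eq_mul]
  ring

lemma norm_signal_sub_sq_le_of_eq_off {φ ψ : Fin K → ℝ} {j : Fin K} (h : ∀ k ≠ j, φ k = ψ k)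
    (s : ℝ) : ‖signal s φ - signal s ψ‖ ^ 2 ≤ s ^ 2 * (φ j - ψ j) ^ 2 := by
  rw [norm_signal_sub_sq, Finset.sum_eq_single j
    (fun k _ hk => by rw [h k hk, sub_self, chordSq_zero]) (by simp)]
  gcongr
  exact chordSq_le_sq _

end Signal

section SecondDifference

lemma abs_exp_sub_one_sub_le_sq_mul_exp (x : ℝ) :
    |Real.exp x - 1 - x| ≤ x ^ 2 * Real.exp |x| := by
  have h := Complex.norm_exp_sub_sum_le_norm_mul_exp (x : ℂ) 2
  simp only [Finset.sum_range_succ, Finset.sum_range_zero, pow_zero, Nat.factorial_zero,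
    Nat.cast_one, div_one, pow_one, zero_add, Nat.factorial_one,
    Complex.norm_real, Real.norm_eq_abs, sq_abs] at h
  rwa [← Complex.ofReal_exp, ← Complex.ofReal_one, ← Complex.ofReal_add, ← Complex.ofReal_sub,
    Complex.norm_real, Real.norm_eq_abs, ← sub_sub] at h

lemma cos_second_difference (x η : ℝ) :
    Real.cos (x + η) + Real.cos (x - η) - 2 * Real.cos x = -(chordSq η * Real.cos x) := by
  rw [chordSq, Real.cos_add, Real.cos_sub]
  ring

/-- The symmetric second difference of `x ↦ exp (t cos x)` with step `η`, which measures the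
effect of changing one phase of a signal by `η`. -/
def expCosDiff (t η x : ℝ) : ℝ :=
  Real.exp (t * Real.cos (x + η)) + Real.exp (t * Real.cos (x - η)) -
    2 * Real.exp (t * Real.cos x)

lemma continuous_expCosDiff (t η : ℝ) : Continuous (expCosDiff t η) := by
  unfold expCosDiff
  fun_prop

lemma expCosDiff_add_eq (t η x : ℝ) :
    expCosDiff t η x + t * chordSq η * Real.cos x =
      Real.exp (t * Real.cos x) *
        ((Real.exp (t * (Real.cos (x + η) - Real.cos x)) - 1 -
            t * (Real.cos (x + η) - Real.cos x)) +
          (Real.exp (t * (Real.cos (x - η) - Real.cos x)) - 1 -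
            t * (Real.cos (x - η) - Real.cos x))) -
        (Real.exp (t * Real.cos x) - 1) * (t * chordSq η * Real.cos x) := by
  have factor (u : ℝ) : Real.exp (t * u) =
      Real.exp (t * Real.cos x) * Real.exp (t * (u - Real.cos x)) := by
    rw [← Real.exp_add, mul_sub, add_sub_cancel]
  rw [expCosDiff, factor (Real.cos (x + η)), factor (Real.cos (x - η))]
  linear_combination Real.exp (t * Real.cos x) * t * cos_second_difference x η

lemma abs_exp_mul_cos_sub_sub_le {t : ℝ} (ht : 0 ≤ t) (ht' : t ≤ 1 / 2) (x y : ℝ) :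
    |Real.exp (t * (Real.cos y - Real.cos x)) - 1 - t * (Real.cos y - Real.cos x)| ≤
      t ^ 2 * (y - x) ^ 2 := by
  have hdiff : |Real.cos y - Real.cos x| ≤ 2 :=
    (abs_sub _ _).trans (by linarith [Real.abs_cos_le_one x, Real.abs_cos_le_one y])
  have hsmall : |t * (Real.cos y - Real.cos x)| ≤ 1 := by
    rw [abs_mul, abs_of_nonneg ht]
    exact (mul_le_mul ht' hdiff (abs_nonneg _) (by norm_num)).trans_eq (by norm_num)
  refine (Real.abs_exp_sub_one_sub_id_le hsmall).trans ?_
  rw [mul_pow]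
  exact mul_le_mul_of_nonneg_left (sq_le_sq.2 (Real.abs_cos_sub_cos_le y x)) (sq_nonneg t)

lemma abs_mul_chordSq_mul_cos_le {t : ℝ} (ht : 0 ≤ t) (η x : ℝ) :
    |t * chordSq η * Real.cos x| ≤ t * η ^ 2 := by
  rw [abs_mul, abs_of_nonneg (mul_nonneg ht (chordSq_nonneg η))]
  exact (mul_le_of_le_one_right (mul_nonneg ht (chordSq_nonneg η)) (Real.abs_cos_le_one x)).trans
    (mul_le_mul_of_nonneg_left (chordSq_le_sq η) ht)

lemma abs_expCosDiff_add_le {t : ℝ} (ht : 0 ≤ t) (ht' : t ≤ 1 / 2) (η x : ℝ) :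
    |expCosDiff t η x + t * chordSq η * Real.cos x| ≤ 6 * t ^ 2 * η ^ 2 := by
  have hcos : |t * Real.cos x| ≤ t := by
    rw [abs_mul, abs_of_nonneg ht]
    exact mul_le_of_le_one_right ht (Real.abs_cos_le_one x)
  have hexp : Real.exp (t * Real.cos x) ≤ 2 :=
    (Real.exp_le_exp.2 ((le_abs_self _).trans (hcos.trans ht'))).trans exp_half_le_two
  have hexp_sub : |Real.exp (t * Real.cos x) - 1| ≤ 2 * t :=
    (Real.abs_exp_sub_one_le (hcos.trans (ht'.trans (by norm_num)))).trans (by gcongr)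
  have hadd := abs_exp_mul_cos_sub_sub_le ht ht' x (x + η)
  have hsub := abs_exp_mul_cos_sub_sub_le ht ht' x (x - η)
  rw [add_sub_cancel_left] at hadd
  rw [sub_sub_cancel_left, neg_sq] at hsub
  rw [expCosDiff_add_eq]
  refine (abs_sub _ _).trans ?_
  rw [abs_mul, abs_mul (_ - 1), abs_of_pos (Real.exp_pos _)]
  calc _ ≤ 2 * (t ^ 2 * η ^ 2 + t ^ 2 * η ^ 2) + 2 * t * (t * η ^ 2) := by
        gcongr
        · exact (abs_add_le _ _).trans (add_le_add hadd hsub)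
        · exact abs_mul_chordSq_mul_cos_le ht η x
    _ = 6 * t ^ 2 * η ^ 2 := by ring

lemma abs_expCosDiff_le {t : ℝ} (ht : 0 ≤ t) (ht' : t ≤ 1 / 2) (η x : ℝ) :
    |expCosDiff t η x| ≤ 4 * t * η ^ 2 := by
  have h := abs_sub (expCosDiff t η x + t * chordSq η * Real.cos x) (t * chordSq η * Real.cos x)
  rw [add_sub_cancel_right] at h
  have ht_sq : t ^ 2 ≤ 1 / 2 * t := by
    rw [sq]
    gcongr
  calc _ ≤ 6 * t ^ 2 * η ^ 2 + t * η ^ 2 :=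
        h.trans (add_le_add (abs_expCosDiff_add_le ht ht' η x) (abs_mul_chordSq_mul_cos_le ht η x))
    _ ≤ 6 * (1 / 2 * t) * η ^ 2 + t * η ^ 2 := by gcongr
    _ = 4 * t * η ^ 2 := by ring

lemma integral_expCosDiff (t η : ℝ) {k : ℕ} (hk : k ≠ 0) :
    ∫ α, expCosDiff t η (k * α) ∂unifAngle = 0 := by
  have hper : Function.Periodic (fun α : ℝ => Real.exp (t * Real.cos (k * α))) (2 * Real.pi) := by
    intro α
    simp only [mul_add, Real.cos_add_nat_mul_two_pi]
  have shift (c : ℝ) : ∫ α, Real.exp (t * Real.cos (k * α + c)) ∂unifAngle =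
      ∫ α, Real.exp (t * Real.cos (k * α)) ∂unifAngle := by
    rw [← integral_unifAngle_add hper (c / k)]
    simp only [mul_add, mul_div_cancel₀ c (Nat.cast_ne_zero.2 hk)]
  simp only [expCosDiff, sub_eq_add_neg (_ * _) η]
  rw [integral_sub (integrable_unifAngle (by fun_prop)) (integrable_unifAngle (by fun_prop)),
    integral_add (integrable_unifAngle (by fun_prop)) (integrable_unifAngle (by fun_prop)),
    integral_const_mul, shift, shift]
  ring

end SecondDifference

section PuncturedKernel

/-- The Dirichlet-type kernel `∑ cos ((k + 1) α)` over all indices `k ≠ j`, which collects the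
contribution of the unchanged phases when only the phase `j` of a signal is changed. -/
def puncturedKernel (j : Fin K) (α : ℝ) : ℝ :=
  ∑ k ∈ Finset.univ.erase j, Real.cos ((k + 1 : ℕ) * α)

lemma continuous_puncturedKernel (j : Fin K) : Continuous (puncturedKernel j) := by
  unfold puncturedKernel
  fun_prop

lemma abs_puncturedKernel_le (j : Fin K) (α : ℝ) : |puncturedKernel j α| ≤ K := by
  refine (Finset.abs_sum_le_sum_abs _ _).trans ((Finset.sum_le_card_nsmul _ _ 1
    fun k _ => Real.abs_cos_le_one _).trans ?_)
  simp

lemma integral_puncturedKernel_mul_cos (j : Fin K) :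
    ∫ α, puncturedKernel j α * Real.cos ((j + 1 : ℕ) * α) ∂unifAngle = 0 := by
  simp_rw [puncturedKernel, Finset.sum_mul]
  rw [integral_finsetSum _ fun k _ => integrable_unifAngle (by fun_prop)]
  refine Finset.sum_eq_zero fun k hk => integral_unifAngle_cos_mul_cos fun h => ?_
  exact Finset.ne_of_mem_erase hk (Fin.ext (by omega))

lemma integral_puncturedKernel_sq_le (j : Fin K) :
    ∫ α, puncturedKernel j α ^ 2 ∂unifAngle ≤ K := by
  have cos_mul_cos_le (k : ℕ) :
      ∫ α, Real.cos (k * α) * Real.cos (k * α) ∂unifAngle ≤ 1 := by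
    have h := integral_mono (μ := unifAngle) (integrable_unifAngle (by fun_prop))
      (integrable_const 1) fun α => (sq (Real.cos (k * α))).symm.trans_le (Real.cos_sq_le_one _)
    rwa [integral_const, probReal_univ, one_smul] at h
  simp_rw [puncturedKernel, sq, Finset.sum_mul_sum]
  rw [integral_finsetSum _ fun k _ => integrable_unifAngle (by fun_prop)]
  refine (Finset.sum_le_card_nsmul _ _ 1 fun k hk => ?_).trans ?_
  · rw [integral_finsetSum _ fun l _ => integrable_unifAngle (by fun_prop),
      Finset.sum_eq_single_of_mem k hk fun l _ hl => integral_unifAngle_cos_mul_cos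
        fun h => hl (Fin.ext (by omega))]
    exact cos_mul_cos_le _
  · simp

-- Expand `exp (t D) = 1 + t D + ⋯` with `D` the punctured kernel: the term `1` drops out since
-- `expCosDiff` has mean zero, and so does the leading part of `expCosDiff` in the term `t D` since
-- `D` is orthogonal to `cos ((j + 1) α)`.
lemma integral_exp_mul_expCosDiff (t η : ℝ) (j : Fin K) :
    ∫ α, Real.exp (t * puncturedKernel j α) * expCosDiff t η ((j + 1 : ℕ) * α) ∂unifAngle =
      ∫ α, ((Real.exp (t * puncturedKernel j α) - 1 - t * puncturedKernel j α) *
          expCosDiff t η ((j + 1 : ℕ) * α) +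
        t * puncturedKernel j α * (expCosDiff t η ((j + 1 : ℕ) * α) +
          t * chordSq η * Real.cos ((j + 1 : ℕ) * α))) ∂unifAngle := by
  have hD := continuous_puncturedKernel j
  have hG := continuous_expCosDiff t η
  have hzero : ∫ α, (expCosDiff t η ((j + 1 : ℕ) * α) - t * (t * chordSq η) *
      (puncturedKernel j α * Real.cos ((j + 1 : ℕ) * α))) ∂unifAngle = 0 := by
    rw [integral_sub (integrable_unifAngle (by fun_prop)) (integrable_unifAngle (by fun_prop)),
      integral_const_mul, integral_puncturedKernel_mul_cos,
      integral_expCosDiff t η j.val.succ_ne_zero, mul_zero, sub_zero]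
  rw [← sub_eq_zero, ← integral_sub (integrable_unifAngle (by fun_prop))
    (integrable_unifAngle (by fun_prop)), ← hzero]
  congr 1 with α
  ring

lemma abs_exp_mul_expCosDiff_remainder_le {t : ℝ} (ht : 0 ≤ t) (ht' : t ≤ 1 / 2) (η : ℝ)
    (j : Fin K) (α : ℝ) :
    |(Real.exp (t * puncturedKernel j α) - 1 - t * puncturedKernel j α) *
          expCosDiff t η ((j + 1 : ℕ) * α) +
        t * puncturedKernel j α * (expCosDiff t η ((j + 1 : ℕ) * α) +
          t * chordSq η * Real.cos ((j + 1 : ℕ) * α))| ≤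
      4 * t ^ 3 * η ^ 2 * Real.exp (K * t) * puncturedKernel j α ^ 2 +
        6 * t ^ 3 * η ^ 2 * K := by
  have hkernel : |t * puncturedKernel j α| ≤ K * t := by
    rw [abs_mul, abs_of_nonneg ht, mul_comm]
    gcongr
    exact abs_puncturedKernel_le j α
  refine (abs_add_le _ _).trans ?_
  rw [abs_mul, abs_mul (t * _)]
  calc _ ≤ (t * puncturedKernel j α) ^ 2 * Real.exp (K * t) * (4 * t * η ^ 2) +
        K * t * (6 * t ^ 2 * η ^ 2) := by
        gcongr
        · exact (abs_exp_sub_one_sub_le_sq_mul_exp _).trans (by gcongr)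
        · exact abs_expCosDiff_le ht ht' η _
        · exact abs_expCosDiff_add_le ht ht' η _
    _ = _ := by ring

lemma abs_integral_exp_mul_expCosDiff_le {t : ℝ} (ht : 0 ≤ t) (ht' : t ≤ 1 / 2) (η : ℝ)
    (j : Fin K) :
    |∫ α, Real.exp (t * puncturedKernel j α) * expCosDiff t η ((j + 1 : ℕ) * α) ∂unifAngle| ≤
      10 * t ^ 3 * K * η ^ 2 * Real.exp (K * t) := by
  have hD := continuous_puncturedKernel j
  have hG := continuous_expCosDiff t η
  rw [integral_exp_mul_expCosDiff]
  calc _ ≤ ∫ α, (4 * t ^ 3 * η ^ 2 * Real.exp (K * t) * puncturedKernel j α ^ 2 +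
        6 * t ^ 3 * η ^ 2 * K) ∂unifAngle :=
        abs_integral_le_integral_abs.trans <| integral_mono (integrable_unifAngle (by fun_prop))
          (integrable_unifAngle (by fun_prop)) (abs_exp_mul_expCosDiff_remainder_le ht ht' η j)
    _ = 4 * t ^ 3 * η ^ 2 * Real.exp (K * t) * ∫ α, puncturedKernel j α ^ 2 ∂unifAngle +
          6 * t ^ 3 * η ^ 2 * K := by
        rw [integral_add (integrable_unifAngle (by fun_prop)) (integrable_const _),
          integral_const_mul, integral_const, probReal_univ, one_smul]
    _ ≤ 4 * t ^ 3 * η ^ 2 * Real.exp (K * t) * K + 6 * t ^ 3 * η ^ 2 * K * Real.exp (K * t) := by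
        refine add_le_add (by gcongr; exact integral_puncturedKernel_sq_le j) ?_
        exact le_mul_of_one_le_right (by positivity) (Real.one_le_exp (by positivity))
    _ = _ := by ring

end PuncturedKernel

section SinglePhase

lemma exp_inner_rotate_signal {φ ψ : Fin K → ℝ} {j : Fin K} (h : ∀ k ≠ j, φ k = ψ k)
    (s α : ℝ) : Real.exp (inner ℝ (rotate α (signal s φ)) (signal s ψ)) =
      Real.exp (s ^ 2 * puncturedKernel j α) *
        Real.exp (s ^ 2 * Real.cos ((j + 1 : ℕ) * α + (φ j - ψ j))) := by
  rw [rotate_signal, inner_signal, ← Real.exp_add, ← mul_add,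
    ← Finset.sum_erase_add _ _ (Finset.mem_univ j), puncturedKernel]
  push_cast
  congr 3
  · refine Finset.sum_congr rfl fun k hk => ?_
    rw [h k (Finset.ne_of_mem_erase hk), add_sub_cancel_left]
  · rw [add_sub_right_comm, add_comm]

lemma chiSqMoment_orbitDensity_signal_le {s : ℝ} (hs : s ^ 2 ≤ 1 / 2) {φ ψ : Fin K → ℝ}
    {j : Fin K} (h : ∀ k ≠ j, φ k = ψ k) :
    chiSqMoment (stdGaussian (Coeff K)) (orbitDensity (signal s φ)) (orbitDensity (signal s ψ)) ≤
      ENNReal.ofReal (1 + 10 * s ^ 6 * K * (φ j - ψ j) ^ 2 * Real.exp (3 * K * s ^ 2 / 2)) := by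
  have integrand (α : ℝ) :
      Real.exp (inner ℝ (rotate α (signal s φ)) (signal s φ)) +
          Real.exp (inner ℝ (rotate α (signal s ψ)) (signal s ψ)) -
        (Real.exp (inner ℝ (rotate α (signal s φ)) (signal s ψ)) +
          Real.exp (inner ℝ (rotate α (signal s ψ)) (signal s φ))) =
      -(Real.exp (s ^ 2 * puncturedKernel j α) *
        expCosDiff (s ^ 2) (φ j - ψ j) ((j + 1 : ℕ) * α)) := by
    rw [exp_inner_rotate_signal (j := j) fun _ _ => rfl,
      exp_inner_rotate_signal (j := j) fun _ _ => rfl, exp_inner_rotate_signal h,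
      exp_inner_rotate_signal fun k hk => (h k hk).symm, sub_self, sub_self, add_zero,
      ← neg_sub (φ j), ← sub_eq_add_neg, expCosDiff]
    ring
  refine (chiSqMoment_orbitDensity_le_one_add _ _).trans (ENNReal.ofReal_le_ofReal ?_)
  simp_rw [integrand]
  rw [integral_neg, norm_signal_sq]
  calc _ ≤ 1 + Real.exp (K * s ^ 2 / 2) *
        (10 * (s ^ 2) ^ 3 * K * (φ j - ψ j) ^ 2 * Real.exp (K * s ^ 2)) := by
        gcongr
        exact (neg_le_abs _).trans
          (abs_integral_exp_mul_expCosDiff_le (sq_nonneg s) hs (φ j - ψ j) j)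
    _ = 1 + 10 * s ^ 6 * K * (φ j - ψ j) ^ 2 *
          (Real.exp (K * s ^ 2 / 2) * Real.exp (K * s ^ 2)) := by ring
    _ = _ := by
        rw [← Real.exp_add]
        ring_nf

end SinglePhase

section QuasiSubadditive

variable {e : ℕ → ℝ}

-- Pair the arguments `i + 1` and `m - 1 - i`, which add up to `m`.
lemma mul_le_four_mul_sum_range (hzero : e 0 = 0) (hnonneg : ∀ i, 0 ≤ e i)
    (hadd : ∀ i j, e (i + j) ≤ 2 * e i + 2 * e j) (m : ℕ) :
    m * e m ≤ 4 * ∑ i ∈ Finset.range m, e (i + 1) := by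
  have hpair : ∀ i ∈ Finset.range m, e m ≤ 2 * e (i + 1) + 2 * e (m - 1 - i) := by
    intro i hi
    have h := hadd (i + 1) (m - 1 - i)
    rwa [show i + 1 + (m - 1 - i) = m by have := Finset.mem_range.1 hi; omega] at h
  have hsum := Finset.card_nsmul_le_sum _ _ _ hpair
  rw [Finset.sum_add_distrib, ← Finset.mul_sum, ← Finset.mul_sum,
    Finset.sum_range_reflect e m, Finset.card_range, nsmul_eq_mul] at hsum
  have hshift : ∑ i ∈ Finset.range m, e i ≤ ∑ i ∈ Finset.range m, e (i + 1) := by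
    have h := Finset.sum_range_succ' e m
    rw [Finset.sum_range_succ, hzero, add_zero] at h
    linarith [hnonneg m]
  linarith

lemma sum_Ico_le_ten_mul_sum_range (hzero : e 0 = 0) (hnonneg : ∀ i, 0 ≤ e i)
    (hadd : ∀ i j, e (i + j) ≤ 2 * e i + 2 * e j) {m n : ℕ} (hn : n ≤ 2 * m) :
    ∑ i ∈ Finset.Ico m n, e (i + 1) ≤ 10 * ∑ i ∈ Finset.range m, e (i + 1) := by
  have hnm : n - m ≤ m := by omega
  have hmul : ((n - m : ℕ) : ℝ) * e m ≤ m * e m := by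
    gcongr
    exact hnonneg m
  have hsub : ∑ i ∈ Finset.range (n - m), e (i + 1) ≤ ∑ i ∈ Finset.range m, e (i + 1) :=
    Finset.sum_le_sum_of_subset_of_nonneg (Finset.range_mono hnm) fun i _ _ => hnonneg _
  calc ∑ i ∈ Finset.Ico m n, e (i + 1)
      ≤ ∑ i ∈ Finset.range (n - m), (2 * e m + 2 * e (i + 1)) := by
        rw [Finset.sum_Ico_eq_sum_range]
        exact Finset.sum_le_sum fun i _ => hadd m (i + 1)
    _ = 2 * (((n - m : ℕ) : ℝ) * e m) + 2 * ∑ i ∈ Finset.range (n - m), e (i + 1) := by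
        rw [Finset.sum_add_distrib, Finset.sum_const, Finset.card_range, nsmul_eq_mul,
          ← Finset.mul_sum]
        ring
    _ ≤ 10 * ∑ i ∈ Finset.range m, e (i + 1) := by
        linarith [mul_le_four_mul_sum_range hzero hnonneg hadd m]

end QuasiSubadditive

section Separation

/-- The upper half of the frequencies, whose phases carry the hypercube; the phases of the other
half are kept fixed, which pins down the rotation. -/
def upperHalf (K : ℕ) : Finset (Fin K) :=
  Finset.univ.filter fun k => (K + 1) / 2 ≤ (k : ℕ)

lemma sum_upperHalf (f : ℕ → ℝ) :
    ∑ k ∈ upperHalf K, f k = ∑ i ∈ Finset.Ico ((K + 1) / 2) K, f i := by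
  rw [upperHalf, Finset.sum_filter,
    Fin.sum_univ_eq_sum_range (fun i => if (K + 1) / 2 ≤ i then f i else 0) K,
    ← Finset.sum_filter, Finset.range_eq_Ico, Finset.Ico_filter_le_of_left_le (Nat.zero_le _)]

lemma sum_compl_upperHalf (f : ℕ → ℝ) :
    ∑ k ∈ (upperHalf K)ᶜ, f k = ∑ i ∈ Finset.range ((K + 1) / 2), f i := by
  have hsplit := Finset.sum_add_sum_compl (upperHalf K) fun k => f k
  rw [sum_upperHalf, Fin.sum_univ_eq_sum_range f K,
    ← Finset.sum_range_add_sum_Ico f (show (K + 1) / 2 ≤ K by omega)] at hsplit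
  linarith

lemma div_three_le_card_upperHalf (hK : 2 ≤ K) : (K : ℝ) / 3 ≤ (upperHalf K).card := by
  have hcard := sum_upperHalf (K := K) fun _ => 1
  rw [Finset.sum_const, Finset.sum_const, nsmul_one, nsmul_one, Nat.card_Ico] at hcard
  rw [hcard, div_le_iff₀ (by norm_num)]
  exact_mod_cast (by omega : K ≤ (K - (K + 1) / 2) * 3)

lemma sum_upperHalf_chordSq_le {d : Fin K → ℝ} (hd : ∀ k ∉ upperHalf K, d k = 0) (a : ℝ) :
    ∑ k ∈ upperHalf K, chordSq (d k) ≤ 22 * ∑ k, chordSq (d k + ((k : ℕ) + 1) * a) := by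
  have hlow : ∑ k ∈ (upperHalf K)ᶜ, chordSq (d k + ((k : ℕ) + 1) * a) =
      ∑ i ∈ Finset.range ((K + 1) / 2), chordSq ((i + 1 : ℕ) * a) := by
    rw [← sum_compl_upperHalf fun i => chordSq ((i + 1 : ℕ) * a)]
    refine Finset.sum_congr rfl fun k hk => ?_
    rw [hd k (Finset.mem_compl.1 hk), zero_add, Nat.cast_succ]
  have hhigh : ∑ k ∈ upperHalf K, chordSq ((k + 1 : ℕ) * a) ≤
      10 * ∑ i ∈ Finset.range ((K + 1) / 2), chordSq ((i + 1 : ℕ) * a) := by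
    rw [sum_upperHalf fun i => chordSq ((i + 1 : ℕ) * a)]
    refine sum_Ico_le_ten_mul_sum_range (e := fun i => chordSq (i * a)) ?_
      (fun i => chordSq_nonneg _) (fun i j => ?_) (by omega)
    · rw [Nat.cast_zero, zero_mul, chordSq_zero]
    · rw [Nat.cast_add, add_mul]
      exact chordSq_add_le _ _
  have hupper : ∑ k ∈ upperHalf K, chordSq (d k) ≤ ∑ k ∈ upperHalf K,
      (2 * chordSq (d k + ((k : ℕ) + 1) * a) + 2 * chordSq ((k + 1 : ℕ) * a)) := by
    refine Finset.sum_le_sum fun k _ => ?_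
    have h := chordSq_add_le (d k + ((k : ℕ) + 1) * a) (-(((k : ℕ) + 1) * a))
    rw [add_neg_cancel_right, chordSq_neg] at h
    rwa [Nat.cast_add_one]
  rw [Finset.sum_add_distrib, ← Finset.mul_sum, ← Finset.mul_sum] at hupper
  have hhigh_nonneg : 0 ≤ ∑ k ∈ upperHalf K, chordSq (d k + ((k : ℕ) + 1) * a) :=
    Finset.sum_nonneg fun k _ => chordSq_nonneg _
  have hlow_nonneg : 0 ≤ ∑ i ∈ Finset.range ((K + 1) / 2), chordSq ((i + 1 : ℕ) * a) :=
    Finset.sum_nonneg fun i _ => chordSq_nonneg _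
  rw [← Finset.sum_add_sum_compl (upperHalf K), hlow]
  linarith

end Separation

section Loss

instance : Nonempty (Set.Ico (-Real.pi) Real.pi) :=
  ⟨⟨0, by simp [Real.pi_pos.le], Real.pi_pos⟩⟩

lemma measurable_loss (θ : Coeff K) : Measurable (loss θ) := by
  have hbdd (θ' : Coeff K) : BddBelow
      (Set.range fun α : Set.Ico (-Real.pi) Real.pi => ‖θ - rotate (α : ℝ) θ'‖ ^ 2) :=
    ⟨0, Set.forall_mem_range.2 fun _ => by positivity⟩
  refine (upperSemicontinuous_ciInf hbdd fun α => Continuous.upperSemicontinuous ?_).measurable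
  have hcont := continuous_rotate (K := K) α
  fun_prop

lemma le_four_mul_loss {θ θ' θ'' : Coeff K} {Δ : ℝ} (hΔ : ∀ α, Δ ≤ ‖θ - rotate α θ'‖ ^ 2)
    (h : loss θ' θ'' ≤ loss θ θ'') : Δ ≤ 4 * loss θ θ'' := by
  refine le_of_forall_pos_le_add fun ε hε => ?_
  have hlt : loss θ θ'' < loss θ θ'' + ε / 4 := by linarith
  obtain ⟨α, hα⟩ := exists_lt_of_ciInf_lt hlt
  obtain ⟨β, hβ⟩ := exists_lt_of_ciInf_lt (h.trans_lt hlt)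
  have hsplit : θ - rotate (α - β) θ' =
      (θ - rotate α θ'') - rotate (α - β) (θ' - rotate β θ'') := by
    rw [rotate_sub, rotate_rotate, sub_add_cancel, sub_sub_sub_cancel_right]
  calc Δ ≤ ‖θ - rotate (α - β) θ'‖ ^ 2 := hΔ _
    _ ≤ (‖θ - rotate α θ''‖ + ‖θ' - rotate β θ''‖) ^ 2 := by
        gcongr
        rw [hsplit, ← norm_rotate (α - β) (θ' - rotate β θ'')]
        exact norm_sub_le _ _
    _ ≤ 2 * (‖θ - rotate α θ''‖ ^ 2 + ‖θ' - rotate β θ''‖ ^ 2) := add_sq_le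
    _ ≤ 4 * loss θ θ'' + ε := by linarith

end Loss

section Hypercube

lemma exists_measurable_argmin {X T : Type*} [MeasurableSpace X] [MeasurableSpace T] [Finite T]
    [Nonempty T] {f : T → X → ℝ} (hf : ∀ t, Measurable (f t)) :
    ∃ g : X → T, Measurable g ∧ ∀ x t, f (g x) x ≤ f t x := by
  classical
  obtain ⟨e, he⟩ := exists_surjective_nat T
  have hex (x : X) : ∃ n, ∀ t, f (e n) x ≤ f t x := by
    obtain ⟨t, ht⟩ := Finite.exists_min fun t => f t x
    obtain ⟨n, rfl⟩ := he t
    exact ⟨n, ht⟩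
  refine ⟨fun x => e (Nat.find (hex x)), ?_, fun x => Nat.find_spec (hex x)⟩
  refine Measurable.find (f := fun n _ => e n) (fun _ => measurable_const) (fun n => ?_) hex
  rw [Set.ofPred_forall]
  exact .iInter fun t => measurableSet_le (hf _) (hf t)

lemma lintegral_card_filter_ne {κ Ω : Type*} [MeasurableSpace Ω] {μ : Measure Ω}
    {g : Ω → κ → Bool} (hg : Measurable g) (S : Finset κ) (τ : κ → Bool) :
    ∫⁻ ω, (S.filter fun k => g ω k ≠ τ k).card ∂μ = ∑ k ∈ S, μ {ω | g ω k ≠ τ k} := by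
  have hmeas (k : κ) : MeasurableSet {ω | g ω k ≠ τ k} :=
    (((measurable_pi_apply k).comp hg) (measurableSet_singleton (τ k))).compl
  have card_eq (ω : Ω) : ((S.filter fun k => g ω k ≠ τ k).card : ENNReal) =
      ∑ k ∈ S, {ω | g ω k ≠ τ k}.indicator 1 ω := by
    simp [Finset.card_filter, Set.indicator_apply]
  simp_rw [card_eq]
  rw [lintegral_finsetSum _ fun k _ => measurable_one.indicator (hmeas k)]
  exact Finset.sum_congr rfl fun k _ => lintegral_indicator_one (hmeas k)

variable {κ Ω : Type*} [DecidableEq κ]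

/-- The neighbour of the point `τ` of the hypercube in direction `k`. -/
def flipAt (k : κ) (τ : κ → Bool) : κ → Bool :=
  Function.update τ k (!τ k)

lemma flipAt_apply_self (k : κ) (τ : κ → Bool) : flipAt k τ k = !τ k :=
  Function.update_self _ _ _

lemma flipAt_apply_of_ne {k l : κ} (h : l ≠ k) (τ : κ → Bool) : flipAt k τ l = τ l :=
  Function.update_of_ne h _ _

lemma flipAt_involutive (k : κ) : Function.Involutive (flipAt k) := by
  intro τ
  simp [flipAt]

variable [MeasurableSpace Ω] {P : (κ → Bool) → Measure Ω}

lemma card_div_four_le_sum_measure_ne [Fintype κ] {f : Ω → Bool} (hf : Measurable f) {k : κ}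
    (htest : ∀ τ A, MeasurableSet A → 1 / 2 ≤ P τ A + P (flipAt k τ) Aᶜ) :
    (Fintype.card (κ → Bool) : ENNReal) / 4 ≤ ∑ τ, P τ {ω | f ω ≠ τ k} := by
  have hpair (τ : κ → Bool) :
      1 / 2 ≤ P τ {ω | f ω ≠ τ k} + P (flipAt k τ) {ω | f ω ≠ flipAt k τ k} := by
    have hcompl : {ω | f ω ≠ flipAt k τ k} = {ω | f ω ≠ τ k}ᶜ := by
      ext ω
      simp [flipAt_apply_self]
    rw [hcompl]
    exact htest τ _ (hf (measurableSet_singleton (τ k))).compl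
  have hsum := Finset.card_nsmul_le_sum Finset.univ _ _ fun τ _ => hpair τ
  have hflip : ∑ τ, P (flipAt k τ) {ω | f ω ≠ flipAt k τ k} = ∑ τ, P τ {ω | f ω ≠ τ k} :=
    Equiv.sum_comp (flipAt_involutive k).toPerm fun τ => P τ {ω | f ω ≠ τ k}
  rw [Finset.sum_add_distrib, hflip, ← two_mul, nsmul_eq_mul, Finset.card_univ] at hsum
  rw [← ENNReal.mul_le_mul_iff_right (a := 2) (by simp) (by simp)]
  refine Eq.trans_le ?_ hsum
  rw [← mul_div_assoc, mul_comm, mul_div_assoc, ← ENNReal.toReal_eq_toReal_iff' (by finiteness)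
    (by finiteness)]
  norm_num

lemma card_div_four_le_iSup_lintegral_card_filter_ne [Finite κ] {S : Finset κ}
    (htest : ∀ τ, ∀ k ∈ S, ∀ A, MeasurableSet A → 1 / 2 ≤ P τ A + P (flipAt k τ) Aᶜ)
    {g : Ω → κ → Bool} (hg : Measurable g) :
    (S.card : ENNReal) / 4 ≤ ⨆ τ, ∫⁻ ω, (S.filter fun k => g ω k ≠ τ k).card ∂P τ := by
  have := Fintype.ofFinite κ
  rw [← ENNReal.mul_le_mul_iff_right (a := Fintype.card (κ → Bool))
    (by simp) (ENNReal.natCast_ne_top _)]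
  calc (Fintype.card (κ → Bool) : ENNReal) * (S.card / 4)
      = ∑ k ∈ S, (Fintype.card (κ → Bool) : ENNReal) / 4 := by
        rw [Finset.sum_const, nsmul_eq_mul, div_eq_mul_inv, div_eq_mul_inv, mul_left_comm]
    _ ≤ ∑ k ∈ S, ∑ τ, P τ {ω | g ω k ≠ τ k} := Finset.sum_le_sum fun k hk =>
        card_div_four_le_sum_measure_ne ((measurable_pi_apply k).comp hg) fun τ => htest τ k hk
    _ = ∑ τ, ∫⁻ ω, (S.filter fun k => g ω k ≠ τ k).card ∂P τ := by
        rw [Finset.sum_comm]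
        simp_rw [lintegral_card_filter_ne hg]
    _ ≤ _ := by
        refine (Finset.sum_le_card_nsmul _ _ _ fun τ _ => le_iSup _ τ).trans_eq ?_
        rw [nsmul_eq_mul, Finset.card_univ]

end Hypercube

section Cube

/-- The phases of the hypothesis `τ`: the bits of the upper half of the frequencies select the
phase `η` or `0`, and the other bits are ignored. -/
def cubePhase (η : ℝ) (τ : Fin K → Bool) (k : Fin K) : ℝ :=
  if k ∈ upperHalf K ∧ τ k = true then η else 0

lemma cubePhase_flipAt_of_ne (η : ℝ) {j k : Fin K} (h : k ≠ j) (τ : Fin K → Bool) :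
    cubePhase η (flipAt j τ) k = cubePhase η τ k := by
  rw [cubePhase, cubePhase, flipAt_apply_of_ne h]

lemma cubePhase_sub_cubePhase_of_notMem (η : ℝ) {k : Fin K} (h : k ∉ upperHalf K)
    (τ τ' : Fin K → Bool) : cubePhase η τ k - cubePhase η τ' k = 0 := by
  simp [cubePhase, h]

lemma cubePhase_sub_cubePhase_sq (η : ℝ) {k : Fin K} (hk : k ∈ upperHalf K)
    (τ τ' : Fin K → Bool) :
    (cubePhase η τ k - cubePhase η τ' k) ^ 2 = if τ' k ≠ τ k then η ^ 2 else 0 := by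
  cases hτ : τ k <;> cases hτ' : τ' k <;> simp [cubePhase, hk, hτ, hτ']

lemma mul_card_filter_ne_le_norm_sub_rotate_sq {r η : ℝ} (hη : η ^ 2 ≤ 1) (τ τ' : Fin K → Bool)
    (α : ℝ) :
    r ^ 2 * η ^ 2 / 55 * ((upperHalf K).filter fun k => τ' k ≠ τ k).card ≤
      ‖signal r (cubePhase η τ) - rotate α (signal r (cubePhase η τ'))‖ ^ 2 := by
  set d : Fin K → ℝ := fun k => cubePhase η τ k - cubePhase η τ' k with hd
  have hchord : ∀ k ∈ upperHalf K,
      (if τ' k ≠ τ k then 2 / 5 * η ^ 2 else 0) ≤ chordSq (d k) := by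
    intro k hk
    have hsq := cubePhase_sub_cubePhase_sq η hk τ τ'
    split_ifs at hsq ⊢ with hne
    · rw [← hsq]
      exact two_fifths_mul_sq_le_chordSq (hsq.trans_le hη)
    · exact chordSq_nonneg _
  have hcard := Finset.sum_le_sum hchord
  rw [← Finset.sum_filter, Finset.sum_const, nsmul_eq_mul] at hcard
  have hsum := hcard.trans (sum_upperHalf_chordSq_le (d := d)
    (fun k hk => cubePhase_sub_cubePhase_of_notMem η hk τ τ') (-α))
  have hphase (k : Fin K) : d k + ((k : ℕ) + 1) * -α =
      cubePhase η τ k - (cubePhase η τ' k + ((k : ℕ) + 1) * α) := by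
    rw [hd]
    ring
  simp only [hphase] at hsum
  rw [rotate_signal, norm_signal_sub_sq]
  nlinarith [sq_nonneg r]

lemma exists_measurable_mul_card_filter_ne_le_loss (r : ℝ) {η : ℝ} (hη : η ^ 2 ≤ 1) :
    ∃ g : Coeff K → Fin K → Bool, Measurable g ∧ ∀ θ τ,
      r ^ 2 * η ^ 2 / 220 * ((upperHalf K).filter fun k => g θ k ≠ τ k).card ≤
        loss (signal r (cubePhase η τ)) θ := by
  obtain ⟨g, hg, hmin⟩ := exists_measurable_argmin
    fun τ : Fin K → Bool => measurable_loss (signal r (cubePhase η τ))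
  refine ⟨g, hg, fun θ τ => ?_⟩
  have hsep := le_four_mul_loss (mul_card_filter_ne_le_norm_sub_rotate_sq (r := r) hη τ (g θ))
    (hmin θ τ)
  linarith

lemma le_minimaxRisk_of_chiSqMoment_le_exp {N : ℕ} {r σ η x : ℝ} (hK : 2 ≤ K) (hr : 0 ≤ r)
    (hσ : σ ≠ 0) (hη : η ^ 2 ≤ 1) (hx : N * x ≤ 1 / 2)
    (h : ∀ (φ ψ : Fin K → ℝ) (j : Fin K), (∀ k ≠ j, φ k = ψ k) → (φ j - ψ j) ^ 2 = η ^ 2 →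
      chiSqMoment (stdGaussian (Coeff K)) (orbitDensity (signal (r / σ) φ))
        (orbitDensity (signal (r / σ) ψ)) ≤ ENNReal.ofReal (Real.exp x)) :
    ENNReal.ofReal (K * r ^ 2 * η ^ 2 / 2640) ≤ minimaxRisk K N σ r := by
  refine le_iInf fun ⟨est, hest⟩ => ?_
  obtain ⟨g, hg, hloss⟩ := exists_measurable_mul_card_filter_ne_le_loss (K := K) r hη
  have htest (τ : Fin K → Bool) (k : Fin K) (hk : k ∈ upperHalf K) (A : Set (Fin N → Coeff K))
      (hA : MeasurableSet A) : 1 / 2 ≤ dataLaw N σ (signal r (cubePhase η τ)) A +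
        dataLaw N σ (signal r (cubePhase η (flipAt k τ))) Aᶜ := by
    refine half_le_dataLaw_add_compl hσ hx ?_ hA
    rw [smul_signal, smul_signal, ← div_eq_inv_mul]
    refine h _ _ k (fun l hl => cubePhase_flipAt_of_ne η hl τ) ?_
    rw [cubePhase_sub_cubePhase_sq η hk, flipAt_apply_self, if_pos (by simp)]
  have hrisk (τ : Fin K → Bool) : ENNReal.ofReal (r ^ 2 * η ^ 2 / 220) *
      ∫⁻ y, ((upperHalf K).filter fun k => g (est y) k ≠ τ k).card
        ∂(dataLaw N σ (signal r (cubePhase η τ))) ≤ risk N σ est (signal r (cubePhase η τ)) := by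
    rw [← lintegral_const_mul' _ _ ENNReal.ofReal_ne_top]
    refine lintegral_mono fun y => ?_
    rw [← ENNReal.ofReal_natCast, ← ENNReal.ofReal_mul (by positivity)]
    exact ENNReal.ofReal_le_ofReal (hloss (est y) τ)
  calc ENNReal.ofReal (K * r ^ 2 * η ^ 2 / 2640)
      = ENNReal.ofReal (r ^ 2 * η ^ 2 / 220) * ENNReal.ofReal (K / 3 / 4) := by
        rw [← ENNReal.ofReal_mul (by positivity)]
        ring_nf
    _ ≤ ENNReal.ofReal (r ^ 2 * η ^ 2 / 220) * ((upperHalf K).card / 4) := by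
        gcongr
        rw [ENNReal.ofReal_div_of_pos (by norm_num), ENNReal.ofReal_ofNat]
        gcongr
        exact ENNReal.ofReal_le_of_le_toReal (div_three_le_card_upperHalf hK)
    _ ≤ ENNReal.ofReal (r ^ 2 * η ^ 2 / 220) * ⨆ τ : Fin K → Bool, ∫⁻ y,
          ((upperHalf K).filter fun k => g (est y) k ≠ τ k).card
            ∂(dataLaw N σ (signal r (cubePhase η τ))) := by
        gcongr
        exact card_div_four_le_iSup_lintegral_card_filter_ne htest (hg.comp hest)
    _ ≤ ⨆ θ : paramSpace K r, risk N σ est θ.1 := by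
        rw [ENNReal.mul_iSup]
        exact iSup_le fun τ => (hrisk τ).trans
          (le_iSup (fun θ : paramSpace K r => risk N σ est θ.1) ⟨_, signal_mem_paramSpace hr _⟩)

lemma le_minimaxRisk_of_chiSqMoment_le_exp_mul_sq {N : ℕ} {r σ A : ℝ} (hK : 2 ≤ K) (hN : 1 ≤ N)
    (hr : 0 ≤ r) (hσ : σ ≠ 0) (hA : 0 < A)
    (h : ∀ (φ ψ : Fin K → ℝ) (j : Fin K), (∀ k ≠ j, φ k = ψ k) →
      chiSqMoment (stdGaussian (Coeff K)) (orbitDensity (signal (r / σ) φ))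
        (orbitDensity (signal (r / σ) ψ)) ≤ ENNReal.ofReal (Real.exp (A * (φ j - ψ j) ^ 2))) :
    ENNReal.ofReal (min (K * r ^ 2 / (N * A)) (K * r ^ 2) / 5280) ≤ minimaxRisk K N σ r := by
  have hNA : 0 < N * A := by positivity
  have hη : √(min (N * A)⁻¹ 1 / 2) ^ 2 = min (N * A)⁻¹ 1 / 2 := Real.sq_sqrt (by positivity)
  have hle_one : min (N * A)⁻¹ 1 ≤ 1 := min_le_right _ _
  have hle_inv : N * A * min (N * A)⁻¹ 1 ≤ 1 :=
    (mul_le_mul_of_nonneg_left (min_le_left _ _) hNA.le).trans_eq (mul_inv_cancel₀ hNA.ne')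
  have hcube := le_minimaxRisk_of_chiSqMoment_le_exp (N := N) (x := A * √(min (N * A)⁻¹ 1 / 2) ^ 2)
    hK hr hσ (by rw [hη]; linarith) (by rw [hη]; linarith) fun φ ψ j hφψ hj => hj ▸ h φ ψ j hφψ
  refine le_of_eq_of_le ?_ hcube
  have hrate : min (K * r ^ 2 / (N * A)) (K * r ^ 2) = K * r ^ 2 * min (N * A)⁻¹ 1 := by
    rw [mul_min_of_nonneg _ _ (by positivity), mul_one, div_eq_mul_inv]
  rw [hη, hrate]
  ring_nf

end Cube

section Regimes

variable {N : ℕ} {r σ : ℝ}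

lemma low_noise_le_minimaxRisk (hK : 2 ≤ K) (hN : 1 ≤ N) (hr : 0 < r) (hσ : 0 < σ) :
    ENNReal.ofReal (min (K * σ ^ 2 / N) (K * r ^ 2) / 5280) ≤ minimaxRisk K N σ r := by
  have hmin := le_minimaxRisk_of_chiSqMoment_le_exp_mul_sq (A := (r / σ) ^ 2) hK hN hr.le hσ.ne'
    (by positivity) fun φ ψ j hφψ => (chiSqMoment_orbitDensity_le _ _).trans (by
      gcongr
      exact norm_signal_sub_sq_le_of_eq_off hφψ _)
  have hrate : K * r ^ 2 / (N * (r / σ) ^ 2) = K * σ ^ 2 / N := by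
    field_simp
  rwa [hrate] at hmin

lemma high_noise_le_minimaxRisk (hK : 2 ≤ K) (hN : 1 ≤ N) (hr : 0 < r) (hσ : 0 < σ)
    (hrσ : (r / σ) ^ 2 ≤ 1 / 2) :
    ENNReal.ofReal (min (σ ^ 6 / (N * r ^ 4 * Real.exp (3 * K * r ^ 2 / (2 * σ ^ 2))))
      (K * r ^ 2) / 52800) ≤ minimaxRisk K N σ r := by
  have hmin := le_minimaxRisk_of_chiSqMoment_le_exp_mul_sq
    (A := 10 * (r / σ) ^ 6 * K * Real.exp (3 * K * (r / σ) ^ 2 / 2)) hK hN hr.le hσ.ne'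
    (by positivity) fun φ ψ j hφψ => (chiSqMoment_orbitDensity_signal_le hrσ hφψ).trans (by
      gcongr
      refine (add_comm _ _).trans_le ((add_le_add_left (le_of_eq ?_) 1).trans
        (Real.add_one_le_exp _))
      ring)
  refine le_trans (ENNReal.ofReal_le_ofReal ?_) hmin
  have hexp : 3 * K * (r / σ) ^ 2 / 2 = 3 * K * r ^ 2 / (2 * σ ^ 2) := by
    field_simp
  have hrate : K * r ^ 2 / (N * (10 * (r / σ) ^ 6 * K *
      Real.exp (3 * K * (r / σ) ^ 2 / 2))) =
      σ ^ 6 / (N * r ^ 4 * Real.exp (3 * K * r ^ 2 / (2 * σ ^ 2))) / 10 := by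
    rw [hexp]
    field_simp
  rw [hrate, show (52800 : ℝ) = 10 * 5280 by norm_num, ← div_div, ← min_div_div_right (by norm_num)]
  gcongr
  exact div_le_self (by positivity) (by norm_num)

lemma sq_div_le_half_of_le (hK : 2 ≤ K) (hN : 1 ≤ N) (hr : 0 < r) (hσ : 0 < σ)
    (h : K * σ ^ 2 / N ≤ σ ^ 6 / (N * r ^ 4 * Real.exp (3 * K * r ^ 2 / (2 * σ ^ 2)))) :
    (r / σ) ^ 2 ≤ 1 / 2 := by
  have hK' : (2 : ℝ) ≤ K := by exact_mod_cast hK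
  set t := (r / σ) ^ 2 with ht
  have ht0 : 0 < t := by positivity
  have hexp : 3 * K * r ^ 2 / (2 * σ ^ 2) = 3 * K * t / 2 := by
    rw [ht]
    field_simp
  have hrate : σ ^ 6 / (N * r ^ 4 * Real.exp (3 * K * t / 2)) *
      (K * t ^ 2 * Real.exp (3 * K * t / 2)) = K * σ ^ 2 / N := by
    rw [ht]
    field_simp
  rw [hexp, ← hrate] at h
  have hle_one : K * t ^ 2 * Real.exp (3 * K * t / 2) ≤ 1 :=
    (mul_le_iff_le_one_right (by positivity)).1 h
  have hexp_ge := Real.add_one_le_exp (3 * K * t / 2)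
  by_contra! hlt
  have hexp_ge' : 5 / 2 ≤ Real.exp (3 * K * t / 2) := by nlinarith
  have hKt : 1 / 2 ≤ K * t ^ 2 := by nlinarith
  nlinarith

end Regimes

end OrbitEstimation

end

theorem lemma11 :
    ∃ c : ℝ, 0 < c ∧
      ∀ (K N : ℕ) (r σ : ℝ), 2 ≤ K → 1 ≤ N → 0 < r → 0 < σ →
        ENNReal.ofReal
            (c * min
              (max ((K : ℝ) * σ ^ 2 / (N : ℝ))
                (σ ^ 6 / ((N : ℝ) * r ^ 4 * Real.exp (3 * (K : ℝ) * r ^ 2 / (2 * σ ^ 2)))))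
              ((K : ℝ) * r ^ 2))
          ≤ OrbitEstimation.minimaxRisk K N σ r := by
  refine ⟨1 / 52800, by norm_num, fun K N r σ hK hN hr hσ => ?_⟩
  rw [one_div_mul_eq_div]
  rcases le_total ((K : ℝ) * σ ^ 2 / N)
    (σ ^ 6 / ((N : ℝ) * r ^ 4 * Real.exp (3 * (K : ℝ) * r ^ 2 / (2 * σ ^ 2)))) with h | h
  · rw [max_eq_right h]
    exact OrbitEstimation.high_noise_le_minimaxRisk hK hN hr hσ
      (OrbitEstimation.sq_div_le_half_of_le hK hN hr hσ h)
  · rw [max_eq_left h]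
    refine le_trans ?_ (OrbitEstimation.low_noise_le_minimaxRisk hK hN hr hσ)
    gcongr
    norm_num
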